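/- Let $d_1<\dots<d_n$ and $\rho_0>\rho_1>\dots>\rho_n$ be real numbers. For a function $f$ on $\mathbb R$ whose Fourier transform $\hat f=\mathscr F(f)$ (normalized by $\hat f(\xi)=\int f(x)e^{-ix\xi}dx$ and understood in the sense of tempered distributions) is a function, and for $s\ge 0$ and a weight $w\ge 0$, put $$\|f\|_s=\int_{\mathbb R}|\xi|^s|\hat f(\xi)|\,d\xi,\qquad \|f\|_{w}=\int_{\mathbb R}w(\xi)|\hat f(\xi)|\,d\xi .$$ Let $\lambda_1(\xi)$ be the smallest eigenvalue of the $n\times n$ matrix $A(\xi)=\big(\tfrac{\rho_{j-1}-\rho_j}{2}e^{-|d_k-d_j||\xi|}\big)_{k,j}$, and let $\tilde\lambda:\mathbb R\to\mathbb R$ be an even function with $\tilde\lambda(0)=0$, non-decreasing on $[0,\infty)$, with $\tilde\lambda(\xi)\le\lambda_1(\xi)$ for all $\xi>0$ and $\tilde\lambda(\xi)\ge\frac{\alpha}{2}|\xi|$ for all $\xi$ near $0$, for some $\alpha>0$. For $k\ne j$ and real functions $g_k,g_j$ write $[g_k,g_j]_y(x)=g_k(x)-g_j(x-y)$ and $$N_{k,j}(x)=\frac{\rho_{j-1}-\rho_j}{2\pi}\int_{\mathbb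 R}\frac{y\,\partial_x[g_k,g_j]_y(x)\left((d_k-d_j)^2-(d_k-d_j+[g_k,g_j]_y(x))^2\right)}{(y^2+(d_k-d_j)^2)\,(y^2+(d_k-d_j+[g_k,g_j]_y(x))^2)}\,dy .$$ Then there is a constant $C_0>0$, depending only on $d_1,\dots,d_n$, such that for every $s\ge0$ the following holds. The series $$F_{2,s}(x)=\sum_{l=1}^\infty(2^sC_0)^l x^{l-1},\qquad F_{1,s}(x)=xF_{2,s}(x)=\sum_{l=1}^\infty(2^sC_0)^l x^{l}$$ define analytic functions on $|x|<(2^sC_0)^{-1}$, of which they are the Taylor series at $0$. Moreover there is a constant $C>0$, depending only on $s$, the $d_i$, the $\rho_i$ and $\tilde\lambda$, such that for all $k\neq j$ and all continuous $g_k,g_j:\mathbb R\to\mathbb R$ for which $\|\cdot\|_0$, $\|\cdot\|_1$ and $\|\cdot\|_{s+1}$ are finite and $2^sC_0(\|g_k\|_0+\|g_j\|_0)<1$, the integral defining $N_{k,j}(x)$ converges absolutely for every $x$, the Fourier transform of $N_{k,j}$ is a function, and $$\begin{aligned}\int_{\mathbb R}|\xi|^s|\mathscr F(N_{k,j})(\xi)|\,d\xi\le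 C\Big[&F_{1,s}(\|g_k\|_0+\|g_j\|_0)\left(\|g_k\|_{\tilde\lambda(\xi)|\xi|^{s+1}}+\|g_j\|_{\tilde\lambda(\xi)|\xi|^{s+1}}\right)\\&+(\|g_k\|_1+\|g_j\|_1)\,F_{2,s}(\|g_k\|_0+\|g_j\|_0)\left(\|g_k\|_{\tilde\lambda(\xi)|\xi|^{s}}+\|g_j\|_{\tilde\lambda(\xi)|\xi|^{s}}\right)\Big].\end{aligned}$$ -/

import Mathlib

open MeasureTheory Filter Topology
open scoped SchwartzMap ENNReal

noncomputable section

namespace Muskat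

/-- The Fourier integral `φ̂(ξ) = ∫ φ(x) e^{-ixξ} dx` (no `2π` in the exponent). -/
def fourierInt (φ : ℝ → ℂ) (ξ : ℝ) : ℂ :=
  ∫ x : ℝ, φ x * Complex.exp (-(Complex.I * (x : ℂ) * (ξ : ℂ)))

/-- The function `F` is the Fourier transform of the function `f`, in the sense of tempered
distributions: `∫ f φ̂ = ∫ F φ` for every Schwartz function `φ`, all integrals being absolutely
convergent. Such an `F` is unique up to a null set; it is the usual Fourier transform when
`f ∈ L¹` or `f ∈ L²`. -/
def IsFourierTransform (f F : ℝ → ℂ) : Prop :=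
  ∀ φ : 𝓢(ℝ, ℂ),
    Integrable (fun x : ℝ => f x * fourierInt (fun t => φ t) x) ∧
    Integrable (fun ξ : ℝ => F ξ * φ ξ) ∧
    ∫ x : ℝ, f x * fourierInt (fun t => φ t) x = ∫ ξ : ℝ, F ξ * φ ξ

/-- The weighted norm `∫ w(ξ) |f̂(ξ)| dξ ∈ [0, ∞]`, as a function of the Fourier transform
`F = f̂`. -/
def weightedNorm (w : ℝ → ℝ) (F : ℝ → ℂ) : ℝ≥0∞ :=
  ∫⁻ ξ : ℝ, ENNReal.ofReal (w ξ) * ‖F ξ‖ₑ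

/-- The Wiener norm `‖f‖_s = ∫ |ξ|^s |f̂(ξ)| dξ ∈ [0, ∞]`, as a function of `F = f̂`. -/
def wienerNorm (s : ℝ) (F : ℝ → ℂ) : ℝ≥0∞ :=
  weightedNorm (fun ξ => |ξ| ^ s) F

/-- `[f, g]_y(x) = f(x) - g(x - y)`. -/
def bracket (f g : ℝ → ℝ) (y x : ℝ) : ℝ := f x - g (x - y)

/-- The density jump `ρ_{j-1} - ρ_j` across the `j`-th interface. The interfaces `1, …, n` are
indexed by `Fin n` and the densities `ρ_0, …, ρ_n` by `Fin (n + 1)`, so that `j : Fin n` is the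
interface between the densities `ρ j.castSucc` (below) and `ρ j.succ` (above). -/
def densityJump {n : ℕ} (ρ : Fin (n + 1) → ℝ) (j : Fin n) : ℝ :=
  ρ j.castSucc - ρ j.succ

/-- The integrand (in `y`) of the nonlinear term `N_{k,j}` at the point `x`. -/
def nonlinearIntegrand {n : ℕ} (d : Fin n → ℝ) (g : Fin n → ℝ → ℝ) (k j : Fin n)
    (x y : ℝ) : ℝ :=
  (y * deriv (fun x' => bracket (g k) (g j) y x') x *
      ((d k - d j) ^ 2 - (d k - d j + bracket (g k) (g j) y x) ^ 2)) /
    ((y ^ 2 + (d k - d j) ^ 2) * (y ^ 2 + (d k - d j + bracket (g k) (g j) y x) ^ 2))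

/-- The nonlinear term `N_{k,j}`, `k ≠ j`, of the multi-phase Muskat system. -/
def nonlinearTerm {n : ℕ} (ρ : Fin (n + 1) → ℝ) (d : Fin n → ℝ) (g : Fin n → ℝ → ℝ)
    (k j : Fin n) (x : ℝ) : ℝ :=
  densityJump ρ j / (2 * Real.pi) * ∫ y : ℝ, nonlinearIntegrand d g k j x y

/-- The matrix `A(ξ)` of the linearized system. -/
def linearMatrix {n : ℕ} (ρ : Fin (n + 1) → ℝ) (d : Fin n → ℝ) (ξ : ℝ) :
    Matrix (Fin n) (Fin n) ℝ :=
  Matrix.of fun k j => densityJump ρ j / 2 * Real.exp (-(|d k - d j| * |ξ|))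

/-- The smallest eigenvalue `λ_1(ξ)` of `A(ξ)`. -/
def lambdaOne {n : ℕ} (ρ : Fin (n + 1) → ℝ) (d : Fin n → ℝ) (ξ : ℝ) : ℝ :=
  sInf {μ : ℝ | Module.End.HasEigenvalue (Matrix.toLin' (linearMatrix ρ d ξ)) μ}

/-- The weights `λ̃`: even functions, vanishing at `0`, non-decreasing on `[0, ∞)`, bounded
above by `λ_1` on `(0, ∞)`, and bounded below by a positive multiple of `|ξ|` near `0`. -/
structure IsTildeLambda {n : ℕ} (ρ : Fin (n + 1) → ℝ) (d : Fin n → ℝ) (lam : ℝ → ℝ) :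
    Prop where
  even : ∀ ξ : ℝ, lam (-ξ) = lam ξ
  zero : lam 0 = 0
  lower : ∃ α : ℝ, 0 < α ∧ ∀ᶠ ξ in 𝓝 (0 : ℝ), α / 2 * |ξ| ≤ lam |ξ|
  mono : MonotoneOn lam (Set.Ici 0)
  le_lambdaOne : ∀ ξ : ℝ, 0 < ξ → lam ξ ≤ lambdaOne ρ d ξ

/-- `F_{2,s}(x) = ∑_{l ≥ 1} (2^s C₀)^l x^{l-1}` (the summation index is shifted by one). -/
def F2 (C₀ s x : ℝ) : ℝ := ∑' l : ℕ, ((2 : ℝ) ^ s * C₀) ^ (l + 1) * x ^ l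

/-- `F_{1,s}(x) = x F_{2,s}(x)`. -/
def F1 (C₀ s x : ℝ) : ℝ := x * F2 C₀ s x

end Muskat

end

open scoped FourierTransform

noncomputable section

namespace Muskat

/-! Write `D = d k - d j` and `b = [g_k, g_j]_y(x)`. The integrand of `N_{k,j}` is `∂_x b` times `y
/ (y² + (D + b)²) - y / (y² + D²)`, which is the real part of `1 / (y + i(D + b)) - 1 / (y + iD)`.
Smallness of the norms forces `|b| < |D|`, so this is a geometric series in `b` with kernels `kern D
m` (`hasSum_kern`).

Fourier inversion makes `b` a superposition of plane waves `exp (i(xξ - ye))`, with `e = 0` for the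
waves of `g_k` and `e = ξ` for those of `g_j`. The `m`-th term is then an integral over tuples of `m
+ 2` waves, one of them differentiated, and integrating in `y` replaces the kernel by its Fourier
transform at the total shift `E = ∑ e_i` (`WaveData.integral_kern_mul`). Instead of writing iterated
convolutions, the amplitude on tuples is pushed forward under the total frequency; the result has an
integrable density (`exists_fourier_density`), and these densities sum to the transform sought.

The weight `λ̃` comes from a cancellation: `kern D m` is the derivative of an integrable function,
so its transform is bounded by a multiple of `|D|⁻¹ ^ m * min 1 |E|` (`norm_kernHat_le`). Since `|e|
≤ |ξ|` for each wave, `|∑ ξ_i|^s min(1, |E|)` is at most `(m + 2)^(s + 1)` times `∑ |ξ_i|^s min(1,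
|ξ_i|)` (`abs_sum_rpow_mul_min_le`), and `min 1 |ξ| ≤ L * λ̃ ξ` (`IsTildeLambda.exists_min_le`). A
weight falling on the differentiated wave produces the `F_1` part of the bound; a weight on one of
the `m + 1` others produces the `F_2` part. The polynomial factors in `m` are absorbed by the choice
of `C₀` (`coeff_le`). -/

/-! ### Fourier inversion in the sense of tempered distributions -/

/-- Precomposition of a Schwartz function with `x ↦ x * c`. -/
def dilate (c : ℝˣ) (φ : 𝓢(ℝ, ℂ)) : 𝓢(ℝ, ℂ) :=
  SchwartzMap.compCLMOfContinuousLinearEquiv ℂ (ContinuousLinearEquiv.unitsEquivAut ℝ c) φ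

lemma dilate_apply (c : ℝˣ) (φ : 𝓢(ℝ, ℂ)) (x : ℝ) : dilate c φ x = φ (x * c) := by
  simp [dilate]

/-- The unit `2π`. -/
def twoPi : ℝˣ := Units.mk0 (2 * Real.pi) (by positivity)

lemma coe_twoPi : (twoPi : ℝ) = 2 * Real.pi := rfl

lemma coe_twoPi_inv : ((twoPi⁻¹ : ℝˣ) : ℝ) = (2 * Real.pi)⁻¹ := rfl

lemma fourierInt_eq_fourier (φ : ℝ → ℂ) (x : ℝ) :
    fourierInt φ x = 𝓕 φ (x * (2 * Real.pi)⁻¹) := by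
  rw [Real.fourier_eq', fourierInt]
  refine integral_congr_ae (Eventually.of_forall fun t => ?_)
  have hpi : (Real.pi : ℂ) ≠ 0 := by exact_mod_cast Real.pi_ne_zero
  simp only [smul_eq_mul]
  rw [mul_comm]
  congr 2
  simp
  field_simp

lemma fourierInt_eq_dilate (φ : 𝓢(ℝ, ℂ)) (x : ℝ) :
    fourierInt (fun t => φ t) x = dilate twoPi⁻¹ (𝓕 φ) x := by
  rw [fourierInt_eq_fourier, dilate_apply, coe_twoPi_inv]
  rfl

/-- Lets the pairing with `φ̂` in `IsFourierTransform` reach every Schwartz test function. -/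
lemma exists_fourierInt_eq (ψ : 𝓢(ℝ, ℂ)) :
    ∃ φ : 𝓢(ℝ, ℂ), ∀ x, fourierInt (fun t => φ t) x = ψ x := by
  refine ⟨𝓕⁻ (dilate twoPi ψ), fun x => ?_⟩
  rw [fourierInt_eq_dilate, FourierTransform.fourier_fourierInv_eq, dilate_apply, dilate_apply,
    coe_twoPi, coe_twoPi_inv]
  congr 1
  field_simp

lemma fourierInt_inversion (φ : 𝓢(ℝ, ℂ)) (ξ : ℝ) :
    (∫ x : ℝ, fourierInt (fun t => φ t) x * Complex.exp (Complex.I * x * ξ)) =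
      2 * Real.pi * φ ξ := by
  have h1 : 𝓕⁻ (𝓕 φ) ξ = φ ξ := by rw [FourierTransform.fourierInv_fourier_eq]
  rw [SchwartzMap.fourierInv_coe, Real.fourierInv_eq'] at h1
  rw [← h1]
  have h2 := Measure.integral_comp_mul_right
    (fun x : ℝ => fourierInt (fun t => φ t) x * Complex.exp (Complex.I * x * ξ)) (2 * Real.pi)
  have hpi : (0 : ℝ) < 2 * Real.pi := by positivity
  rw [abs_of_pos (by positivity)] at h2
  have h3 : (∫ x : ℝ, fourierInt (fun t => φ t) x * Complex.exp (Complex.I * x * ξ)) =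
      (2 * Real.pi : ℝ) • ∫ x : ℝ, fourierInt (fun t => φ t) (x * (2 * Real.pi)) *
        Complex.exp (Complex.I * (x * (2 * Real.pi) : ℝ) * ξ) := by
    rw [h2, smul_smul, mul_inv_cancel₀ hpi.ne', one_smul]
  rw [h3, Complex.real_smul]
  push_cast
  congr 1
  refine integral_congr_ae (Eventually.of_forall fun t => ?_)
  simp only [smul_eq_mul]
  rw [fourierInt_eq_fourier, mul_assoc t, mul_inv_cancel₀ hpi.ne', mul_one, mul_comm]
  congr 2
  simp
  ring

/-- The inverse Fourier integral, normalised to be inverse to `fourierInt`. -/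
def invFourierInt (H : ℝ → ℂ) (x : ℝ) : ℂ :=
  (2 * Real.pi : ℂ)⁻¹ * ∫ ξ : ℝ, H ξ * Complex.exp (Complex.I * x * ξ)

lemma norm_exp_I_mul_mul (x y : ℝ) : ‖Complex.exp (Complex.I * x * y)‖ = 1 := by
  rw [Complex.norm_exp]; simp

lemma continuous_invFourierInt {H : ℝ → ℂ} (hH : Integrable H) :
    Continuous (invFourierInt H) := by
  refine continuous_const.mul (continuous_of_dominated (bound := fun ξ => ‖H ξ‖) ?_ ?_ hH.norm ?_)
  · exact fun x => hH.aestronglyMeasurable.mul (by fun_prop)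
  · exact fun x => Eventually.of_forall fun ξ => by rw [norm_mul, norm_exp_I_mul_mul, mul_one]
  · exact Eventually.of_forall fun ξ => by fun_prop

lemma norm_invFourierInt_le (H : ℝ → ℂ) (x : ℝ) :
    ‖invFourierInt H x‖ ≤ (2 * Real.pi)⁻¹ * ∫ ξ, ‖H ξ‖ := by
  rw [invFourierInt, norm_mul]
  have : ‖(2 * Real.pi : ℂ)⁻¹‖ = (2 * Real.pi)⁻¹ := by
    rw [norm_inv, norm_mul, Complex.norm_real, Real.norm_of_nonneg Real.pi_pos.le]; simp
  rw [this]
  gcongr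
  refine (norm_integral_le_integral_norm _).trans_eq ?_
  simp_rw [norm_mul, norm_exp_I_mul_mul, mul_one]

/-- Fubini, justified by the integrability of `H ⊗ φ̂`, moves the exponential onto `φ̂`, where
inversion for Schwartz functions applies. -/
lemma isFourierTransform_invFourierInt {H : ℝ → ℂ} (hH : Integrable H) :
    IsFourierTransform (invFourierInt H) H := by
  intro φ
  have hφ : Integrable (fun x => fourierInt (fun t => φ t) x) := by
    simp_rw [fourierInt_eq_dilate]; exact SchwartzMap.integrable _
  have hpi : (2 * Real.pi : ℂ) ≠ 0 := by exact_mod_cast (by positivity : (2 * Real.pi : ℝ) ≠ 0)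
  refine ⟨?_, ?_, ?_⟩
  · exact hφ.bdd_mul (continuous_invFourierInt hH).aestronglyMeasurable
      (Eventually.of_forall (norm_invFourierInt_le H))
  · refine hH.mul_bdd φ.continuous.aestronglyMeasurable
      (c := SchwartzMap.seminorm ℝ 0 0 φ) (Eventually.of_forall fun x => ?_)
    exact φ.norm_le_seminorm ℝ x
  · have hint : Integrable (Function.uncurry fun x ξ : ℝ =>
        H ξ * Complex.exp (Complex.I * x * ξ) * fourierInt (fun t => φ t) x)
        (volume.prod volume) := by
      have h := (hφ.mul_prod hH).mul_bdd (c := 1)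
        (g := fun z : ℝ × ℝ => Complex.exp (Complex.I * z.1 * z.2))
        (Continuous.aestronglyMeasurable (by fun_prop)) (Eventually.of_forall fun z => (norm_exp_I_mul_mul _ _).le)
      refine h.congr (Eventually.of_forall fun z => ?_)
      simp only [Function.uncurry]
      ring
    calc ∫ x : ℝ, invFourierInt H x * fourierInt (fun t => φ t) x
        = (2 * Real.pi : ℂ)⁻¹ * ∫ x : ℝ, ∫ ξ : ℝ,
            H ξ * Complex.exp (Complex.I * x * ξ) * fourierInt (fun t => φ t) x := by
          rw [← integral_const_mul]
          refine integral_congr_ae (Eventually.of_forall fun x => ?_)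
          simp only [invFourierInt, mul_assoc]
          rw [← integral_mul_const]
          simp only [mul_assoc]
      _ = (2 * Real.pi : ℂ)⁻¹ * ∫ ξ : ℝ, ∫ x : ℝ,
            H ξ * Complex.exp (Complex.I * x * ξ) * fourierInt (fun t => φ t) x := by
          rw [integral_integral_swap hint]
      _ = ∫ ξ : ℝ, H ξ * φ ξ := by
          rw [← integral_const_mul]
          refine integral_congr_ae (Eventually.of_forall fun ξ => ?_)
          simp only [mul_assoc, integral_const_mul]
          have := fourierInt_inversion φ ξ
          simp only [mul_comm (fourierInt _ _), mul_assoc] at this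
          rw [this]
          field_simp

lemma exists_schwartz_eq_ofReal {g : ℝ → ℝ} (hg : ContDiff ℝ (⊤ : ℕ∞) g)
    (hgs : HasCompactSupport g) : ∃ ψ : 𝓢(ℝ, ℂ), ∀ x, ψ x = (g x : ℂ) := by
  have hgs' : HasCompactSupport (Complex.ofRealCLM ∘ g) := hgs.comp_left (by simp)
  exact ⟨hgs'.toSchwartzMap (Complex.ofRealCLM.contDiff.comp hg), fun x => rfl⟩

/-- Every smooth compactly supported function is some `φ̂`, so `f - f'` integrates to zero against
all of them and vanishes almost everywhere; continuity removes the null set. -/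
lemma IsFourierTransform.eq_of_continuous {f f' H : ℝ → ℂ} (hf : IsFourierTransform f H)
    (hf' : IsFourierTransform f' H) (hc : Continuous f) (hc' : Continuous f') : f = f' := by
  have hloc : LocallyIntegrable (fun x => f x - f' x) volume := (hc.sub hc').locallyIntegrable
  have h0 := ae_eq_zero_of_integral_contDiff_smul_eq_zero hloc fun g hg hgs => by
    obtain ⟨ψ, hψ⟩ := exists_schwartz_eq_ofReal hg hgs
    obtain ⟨φ, hφ⟩ := exists_fourierInt_eq ψ
    obtain ⟨h1, -, h2⟩ := hf φ
    obtain ⟨h1', -, h2'⟩ := hf' φ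
    have h3 := integral_sub h1 h1'
    rw [h2, h2', sub_self] at h3
    rw [← h3]
    refine integral_congr_ae (Eventually.of_forall fun x => ?_)
    simp only [hφ, hψ, Complex.real_smul]
    ring
  refine (hc.ae_eq_iff_eq volume hc').1 ?_
  filter_upwards [h0] with x hx using sub_eq_zero.1 hx

/-- The definition only gives integrability of `H * φ`. Taking for `φ` bumps equal to `1` on growing
balls exhibits `H` as a pointwise limit of measurable functions. -/
lemma IsFourierTransform.aestronglyMeasurable {f H : ℝ → ℂ} (hf : IsFourierTransform f H) :
    AEStronglyMeasurable H := by
  have hb : ∀ n : ℕ, ∃ φ : 𝓢(ℝ, ℂ), ∀ x ∈ Metric.closedBall (0 : ℝ) (n + 1), φ x = 1 := by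
    intro n
    let b : ContDiffBump (0 : ℝ) := ⟨n + 1, n + 2, by positivity, by linarith⟩
    obtain ⟨ψ, hψ⟩ := exists_schwartz_eq_ofReal b.contDiff b.hasCompactSupport
    refine ⟨ψ, fun x hx => ?_⟩
    rw [hψ, b.one_of_mem_closedBall hx, Complex.ofReal_one]
  choose φ hφ using hb
  refine aestronglyMeasurable_of_tendsto_ae atTop
    (fun n => (hf (φ n)).2.1.aestronglyMeasurable) (Eventually.of_forall fun x => ?_)
  obtain ⟨m, hm⟩ := exists_nat_ge |x|
  refine tendsto_const_nhds.congr' ?_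
  filter_upwards [eventually_ge_atTop m] with n hn
  rw [hφ n x, mul_one]
  have : (m : ℝ) ≤ n := by exact_mod_cast hn
  simp only [Metric.mem_closedBall, dist_zero_right, Real.norm_eq_abs]
  linarith

/-- A continuous function whose Fourier transform is integrable is given by the inversion
formula. -/
lemma IsFourierTransform.eq_invFourierInt {f H : ℝ → ℂ} (hf : IsFourierTransform f H)
    (hc : Continuous f) (hH : Integrable H) : f = invFourierInt H :=
  hf.eq_of_continuous (isFourierTransform_invFourierInt hH) hc (continuous_invFourierInt hH)

/-! ### The expansion kernels and the decay of their Fourier transforms -/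

/-- The coefficients of the expansion of `y / (y² + (D + b)²) - y / (y² + D²)` in powers of `b`. -/
def kern (D : ℝ) (m : ℕ) (y : ℝ) : ℝ :=
  ((-Complex.I) ^ (m + 1) / ((y : ℂ) + Complex.I * D) ^ (m + 2)).re

/-- A primitive of `kern D m` that is integrable on the line. -/
def kernPrim (D : ℝ) (m : ℕ) (y : ℝ) : ℝ :=
  (-((-Complex.I) ^ (m + 1) / ((m + 1 : ℂ) * ((y : ℂ) + Complex.I * D) ^ (m + 1)))).re

lemma norm_add_I_mul_sq (D y : ℝ) : ‖(y : ℂ) + Complex.I * D‖ ^ 2 = y ^ 2 + D ^ 2 := by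
  rw [← Complex.normSq_eq_norm_sq, Complex.normSq_apply]
  simp
  ring

lemma abs_le_norm_add_I_mul (D y : ℝ) : |D| ≤ ‖(y : ℂ) + Complex.I * D‖ := by
  refine abs_le_of_sq_le_sq' ?_ (norm_nonneg _) |>.2
  rw [norm_add_I_mul_sq, sq_abs]
  nlinarith [sq_nonneg y]

lemma add_I_mul_ne_zero {D : ℝ} (hD : D ≠ 0) (y : ℝ) : (y : ℂ) + Complex.I * D ≠ 0 := by
  rw [← norm_pos_iff]
  exact (abs_pos.2 hD).trans_le (abs_le_norm_add_I_mul D y)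

/-- Of the `m + 2` factors in the denominator, `m` are bounded below by `|D|` and two are kept for
integrability in `y`. -/
lemma abs_kern_le {D : ℝ} (hD : D ≠ 0) (m : ℕ) (y : ℝ) :
    |kern D m y| ≤ |D|⁻¹ ^ m * (y ^ 2 + D ^ 2)⁻¹ := by
  refine (Complex.abs_re_le_norm _).trans ?_
  rw [norm_div, norm_pow, norm_pow, norm_neg, Complex.norm_I, one_pow, pow_add, norm_add_I_mul_sq,
    one_div, mul_inv, ← inv_pow]
  have := abs_pos.2 hD
  gcongr
  exact abs_le_norm_add_I_mul D y

/-- The case `m = 0` needs the real part: `i / (y + iD)` has modulus of order `1 / |y|`, which is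
not integrable, but its real part is `D / (y² + D²)`. For `m ≥ 1` the modulus suffices. -/
lemma abs_kernPrim_le {D : ℝ} (hD : D ≠ 0) (m : ℕ) (y : ℝ) :
    |kernPrim D m y| ≤ |D| * (|D|⁻¹ ^ m * (y ^ 2 + D ^ 2)⁻¹) := by
  have hD' := abs_pos.2 hD
  rcases m with _ | m
  · have : kernPrim D 0 y = D * (y ^ 2 + D ^ 2)⁻¹ := by
      have h : (-((-Complex.I) ^ (0 + 1) / (((0 : ℕ) + 1 : ℂ) *
          ((y : ℂ) + Complex.I * D) ^ (0 + 1)))) =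
          Complex.I / ((y : ℂ) + Complex.I * D) := by
        simp [neg_div]
      rw [kernPrim, h, Complex.div_re, Complex.normSq_eq_norm_sq, norm_add_I_mul_sq]
      simp [div_eq_mul_inv]
    rw [this, abs_mul, abs_inv, abs_of_nonneg (by positivity : 0 ≤ y ^ 2 + D ^ 2)]
    simp
  · refine (Complex.abs_re_le_norm _).trans ?_
    rw [norm_neg, norm_div, norm_pow, norm_mul, norm_pow, norm_neg, Complex.norm_I, one_pow]
    have h1 : ‖((m + 1 : ℕ) + 1 : ℂ)‖ = (m : ℝ) + 2 := by
      rw [show ((m + 1 : ℕ) + 1 : ℂ) = ((m + 2 : ℕ) : ℂ) by push_cast; ring, Complex.norm_natCast]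
      push_cast; ring
    rw [h1, pow_add _ m 2, norm_add_I_mul_sq, pow_succ |D|⁻¹ m, one_div, mul_inv, mul_inv, ← inv_pow]
    have h2 : |D| * (|D|⁻¹ ^ m * |D|⁻¹ * (y ^ 2 + D ^ 2)⁻¹) =
        1 * (|D|⁻¹ ^ m * (y ^ 2 + D ^ 2)⁻¹) := by field_simp
    rw [h2]
    gcongr
    · exact inv_le_one_of_one_le₀ (by linarith [(Nat.cast_nonneg m : (0 : ℝ) ≤ m)])
    · exact abs_le_norm_add_I_mul D y

lemma hasDerivAt_kernPrim {D : ℝ} (hD : D ≠ 0) (m : ℕ) (y : ℝ) :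
    HasDerivAt (kernPrim D m) (kern D m y) y := by
  have hz := add_I_mul_ne_zero hD y
  have h1 : HasDerivAt (fun t : ℝ => (t : ℂ) + Complex.I * D) 1 y :=
    (Complex.ofRealCLM.hasDerivAt (x := y)).add_const _
  have hm : (m + 1 : ℂ) ≠ 0 := by exact_mod_cast Nat.succ_ne_zero m
  have h2 : HasDerivAt (fun t : ℝ => -((-Complex.I) ^ (m + 1) /
      ((m + 1 : ℂ) * ((t : ℂ) + Complex.I * D) ^ (m + 1))))
      ((-Complex.I) ^ (m + 1) / ((y : ℂ) + Complex.I * D) ^ (m + 2)) y := by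
    have h := ((hasDerivAt_const y ((-Complex.I) ^ (m + 1))).div
      (((h1.pow (m + 1))).const_mul (m + 1 : ℂ)) (mul_ne_zero hm (pow_ne_zero _ hz))).neg
    refine h.congr_deriv ?_
    simp only [Pi.pow_apply, Nat.add_sub_cancel, Nat.cast_add, Nat.cast_one]
    generalize (y : ℂ) + Complex.I * D = z at hz
    generalize (-Complex.I) ^ (m + 1) = w
    field_simp
    ring
  exact Complex.reCLM.hasFDerivAt.comp_hasDerivAt y h2

lemma continuous_kern {D : ℝ} (hD : D ≠ 0) (m : ℕ) : Continuous (kern D m) := by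
  refine Complex.continuous_re.comp (continuous_const.div (by fun_prop) fun y => ?_)
  exact pow_ne_zero _ (add_I_mul_ne_zero hD y)

lemma continuous_kernPrim {D : ℝ} (hD : D ≠ 0) (m : ℕ) : Continuous (kernPrim D m) :=
  continuous_iff_continuousAt.2 fun y => (hasDerivAt_kernPrim hD m y).continuousAt

lemma integrable_inv_sq_add_sq {D : ℝ} (hD : D ≠ 0) :
    Integrable fun y : ℝ => (y ^ 2 + D ^ 2)⁻¹ := by
  have h := ((integrable_inv_one_add_sq).comp_mul_right' (inv_ne_zero hD)).const_mul ((D ^ 2)⁻¹)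
  refine h.congr (Eventually.of_forall fun y => ?_)
  simp only
  rw [← mul_inv]
  congr 1
  field_simp
  ring

/-- The total mass of the Poisson-type kernel `1 / (y² + D²)`. -/
def poissonMass (D : ℝ) : ℝ := ∫ y : ℝ, (y ^ 2 + D ^ 2)⁻¹

lemma poissonMass_nonneg (D : ℝ) : 0 ≤ poissonMass D :=
  integral_nonneg fun y => by positivity

lemma integrable_kern {D : ℝ} (hD : D ≠ 0) (m : ℕ) : Integrable (kern D m) :=
  ((integrable_inv_sq_add_sq hD).const_mul (|D|⁻¹ ^ m)).mono'
    (continuous_kern hD m).aestronglyMeasurable (Eventually.of_forall (abs_kern_le hD m))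

lemma integrable_kernPrim {D : ℝ} (hD : D ≠ 0) (m : ℕ) : Integrable (kernPrim D m) :=
  (((integrable_inv_sq_add_sq hD).const_mul (|D|⁻¹ ^ m)).const_mul |D|).mono'
    (continuous_kernPrim hD m).aestronglyMeasurable (Eventually.of_forall (abs_kernPrim_le hD m))

lemma integral_abs_kern_le {D : ℝ} (hD : D ≠ 0) (m : ℕ) :
    ∫ y, |kern D m y| ≤ |D|⁻¹ ^ m * poissonMass D := by
  rw [poissonMass, ← integral_const_mul]
  exact integral_mono (integrable_kern hD m).abs
    ((integrable_inv_sq_add_sq hD).const_mul _) (abs_kern_le hD m)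

lemma integral_abs_kernPrim_le {D : ℝ} (hD : D ≠ 0) (m : ℕ) :
    ∫ y, |kernPrim D m y| ≤ |D| * (|D|⁻¹ ^ m * poissonMass D) := by
  rw [poissonMass, ← integral_const_mul, ← integral_const_mul]
  exact integral_mono (integrable_kernPrim hD m).abs
    (((integrable_inv_sq_add_sq hD).const_mul _).const_mul _) (abs_kernPrim_le hD m)

lemma norm_exp_neg_I_mul_mul (x y : ℝ) : ‖Complex.exp (-(Complex.I * x * y))‖ = 1 := by
  rw [Complex.norm_exp]; simp

lemma norm_fourierInt_le (φ : ℝ → ℂ) (E : ℝ) : ‖fourierInt φ E‖ ≤ ∫ y, ‖φ y‖ := by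
  refine (norm_integral_le_integral_norm _).trans_eq ?_
  simp_rw [norm_mul, norm_exp_neg_I_mul_mul, mul_one]

lemma integrable_mul_exp_neg {φ : ℝ → ℂ} (hφ : Integrable φ) (E : ℝ) :
    Integrable fun y : ℝ => φ y * Complex.exp (-(Complex.I * y * E)) :=
  hφ.mul_bdd (c := 1) (Continuous.aestronglyMeasurable (by fun_prop))
    (Eventually.of_forall fun y => (norm_exp_neg_I_mul_mul y E).le)

/-- The Fourier transform of `kern D m`. -/
def kernHat (D : ℝ) (m : ℕ) (E : ℝ) : ℂ := fourierInt (fun y => (kern D m y : ℂ)) E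

/-- Integration by parts; it shows that the transform vanishes linearly at `E = 0`. -/
lemma kernHat_eq {D : ℝ} (hD : D ≠ 0) (m : ℕ) (E : ℝ) :
    kernHat D m E = Complex.I * E * fourierInt (fun y => (kernPrim D m y : ℂ)) E := by
  have hu : ∀ y : ℝ, HasDerivAt (fun y : ℝ => Complex.exp (-(Complex.I * y * E)))
      (-(Complex.I * E) * Complex.exp (-(Complex.I * y * E))) y := by
    intro y
    have h1 : HasDerivAt (fun t : ℝ => -(Complex.I * t * E)) (-(Complex.I * 1 * E)) y :=
      (((Complex.ofRealCLM.hasDerivAt (x := y)).const_mul Complex.I).mul_const (E : ℂ)).neg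
    convert h1.cexp using 1
    ring
  have hv : ∀ y : ℝ, HasDerivAt (fun y : ℝ => (kernPrim D m y : ℂ)) (kern D m y : ℂ) y :=
    fun y => (hasDerivAt_kernPrim hD m y).ofReal_comp
  have hi1 := integrable_mul_exp_neg ((integrable_kern hD m).ofReal (𝕜 := ℂ)) E
  have hi2 := integrable_mul_exp_neg ((integrable_kernPrim hD m).ofReal (𝕜 := ℂ)) E
  have h := integral_mul_deriv_eq_deriv_mul_of_integrable (fun x _ => hu x) (fun x _ => hv x)
    (hi1.congr (Eventually.of_forall fun y => by simp only [Pi.mul_apply]; exact mul_comm _ _))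
    ((hi2.const_mul (-(Complex.I * E))).congr (Eventually.of_forall fun y => by
      simp only [Pi.mul_apply]
      change -(Complex.I * E) * ((kernPrim D m y : ℂ) * _) = _
      ring))
    (hi2.congr (Eventually.of_forall fun y => by simp only [Pi.mul_apply]; exact mul_comm _ _))
  rw [kernHat, fourierInt, fourierInt, ← integral_const_mul]
  simp_rw [mul_comm ((kern D m _ : ℝ) : ℂ)]
  rw [h, ← integral_neg]
  refine integral_congr_ae (Eventually.of_forall fun y => ?_)
  simp only
  ring

/-- The `L¹` norm of `kern D m` bounds large `E`, that of `kernPrim D m` bounds small `E`. The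
factor `min 1 |E|` is what later becomes the weight `λ̃`. -/
lemma norm_kernHat_le {D : ℝ} (hD : D ≠ 0) (m : ℕ) (E : ℝ) :
    ‖kernHat D m E‖ ≤ (1 + |D|) * poissonMass D * |D|⁻¹ ^ m * min 1 |E| := by
  have hJ := poissonMass_nonneg D
  have h1 : ‖kernHat D m E‖ ≤ |D|⁻¹ ^ m * poissonMass D := by
    refine (norm_fourierInt_le _ _).trans ?_
    simp only [Complex.norm_real, Real.norm_eq_abs]
    exact integral_abs_kern_le hD m
  have h2 : ‖kernHat D m E‖ ≤ |E| * (|D| * (|D|⁻¹ ^ m * poissonMass D)) := by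
    rw [kernHat_eq hD, norm_mul, norm_mul, Complex.norm_I, one_mul, Complex.norm_real,
      Real.norm_eq_abs]
    gcongr
    refine (norm_fourierInt_le _ _).trans ?_
    simp only [Complex.norm_real, Real.norm_eq_abs]
    exact integral_abs_kernPrim_le hD m
  have hA : 0 ≤ |D|⁻¹ ^ m * poissonMass D := by positivity
  rcases le_total 1 |E| with h | h
  · rw [min_eq_left h]
    nlinarith [abs_nonneg D, mul_nonneg (abs_nonneg D) hA]
  · rw [min_eq_right h]
    nlinarith [abs_nonneg E, mul_nonneg (abs_nonneg E) hA]

/-- With `z = y + iD` and `q = -ib / z`, one has `1 / (z + ib) - 1 / z = z⁻¹ q / (1 - q)`, and `|q|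
< 1` because `|z| ≥ |D|`. Take real parts of the geometric series. -/
lemma hasSum_kern {D b : ℝ} (hD : D ≠ 0) (hb : |b| < |D|) (y : ℝ) :
    HasSum (fun m => kern D m y * b ^ (m + 1))
      (y / (y ^ 2 + (D + b) ^ 2) - y / (y ^ 2 + D ^ 2)) := by
  have hz := add_I_mul_ne_zero hD y
  have hDb : D + b ≠ 0 := by
    intro h
    rw [eq_neg_of_add_eq_zero_left h, abs_neg] at hb
    exact lt_irrefl _ hb
  have hz' := add_I_mul_ne_zero hDb y
  set z : ℂ := (y : ℂ) + Complex.I * D with hzdef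
  have hre : ∀ c : ℝ, (((y : ℂ) + Complex.I * c)⁻¹).re = y / (y ^ 2 + c ^ 2) := by
    intro c
    rw [Complex.inv_re, Complex.normSq_eq_norm_sq, norm_add_I_mul_sq]
    simp
  have hq : ‖-Complex.I * b / z‖ < 1 := by
    rw [norm_div, norm_mul, norm_neg, Complex.norm_I, one_mul, Complex.norm_real, Real.norm_eq_abs,
      div_lt_one (norm_pos_iff.2 hz)]
    exact hb.trans_le (abs_le_norm_add_I_mul D y)
  have hs := ((hasSum_geometric_of_norm_lt_one hq).mul_left (-Complex.I * b / z ^ 2))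
  have hs' := Complex.hasSum_re hs
  have hq1 : 1 - -Complex.I * b / z ≠ 0 := by
    intro h
    rw [← sub_eq_zero.1 h, norm_one] at hq
    exact lt_irrefl _ hq
  have hval : -Complex.I * b / z ^ 2 * (1 - -Complex.I * b / z)⁻¹ =
      ((y : ℂ) + Complex.I * (D + b : ℝ))⁻¹ - z⁻¹ := by
    have e : (y : ℂ) + Complex.I * (D + b : ℝ) = z * (1 - -Complex.I * b / z) := by
      rw [mul_sub, mul_div_cancel₀ _ hz, hzdef]; push_cast; ring
    rw [e, mul_inv, sq, ← div_div]
    generalize -Complex.I * b / z = q at hq1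
    field_simp
    ring
  rw [hval, Complex.sub_re, hre, hzdef, hre] at hs'
  refine hs'.congr_fun fun m => ?_
  rw [kern, ← hzdef, ← Complex.re_mul_ofReal, div_pow, mul_pow]
  congr 1
  push_cast
  field_simp
  ring

/-! ### Push-forward of amplitudes to densities on the frequency line -/

section Pushforward

variable {Z : Type*} [MeasurableSpace Z] {m : Measure Z} {T : Z → ℝ}

/-- The push-forward of `f dm` is a finite measure, absolutely continuous because `T` does not
charge null sets; `h` is its Radon–Nikodym derivative. -/
lemma exists_lintegral_density (hT : Measure.QuasiMeasurePreserving T m volume)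
    {f : Z → ℝ≥0∞} (hf : AEMeasurable f m) (hfi : ∫⁻ z, f z ∂m ≠ ⊤) :
    ∃ h : ℝ → ℝ≥0∞, Measurable h ∧ (∫⁻ ξ, h ξ ≠ ⊤) ∧
      (∀ w : ℝ → ℝ≥0∞, Measurable w → ∫⁻ ξ, w ξ * h ξ = ∫⁻ z, w (T z) * f z ∂m) ∧
      ∀ u : ℝ → ℂ, Measurable u →
        ∫ ξ, ((h ξ).toReal : ℂ) * u ξ = ∫ z, ((f z).toReal : ℂ) * u (T z) ∂m := by
  set M : Measure ℝ := (m.withDensity f).map T with hM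
  have : IsFiniteMeasure (m.withDensity f) := isFiniteMeasure_withDensity hfi
  have hMfin : IsFiniteMeasure M := by rw [hM]; infer_instance
  have hac : M ≪ volume :=
    ((withDensity_absolutelyContinuous m f).map hT.measurable).trans hT.absolutelyContinuous
  have hMd : volume.withDensity (M.rnDeriv volume) = M := Measure.withDensity_rnDeriv_eq _ _ hac
  have hlt : ∀ᵐ z ∂m, f z < ⊤ := ae_lt_top' hf hfi
  refine ⟨M.rnDeriv volume, Measure.measurable_rnDeriv _ _,
    (Measure.lintegral_rnDeriv_lt_top M volume).ne, fun w hw => ?_, fun u hu => ?_⟩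
  · calc ∫⁻ ξ, w ξ * M.rnDeriv volume ξ = ∫⁻ ξ, w ξ ∂M := by
          rw [← hMd, lintegral_withDensity_eq_lintegral_mul _ (Measure.measurable_rnDeriv _ _) hw,
            hMd]
          simp only [Pi.mul_apply, mul_comm]
      _ = ∫⁻ z, w (T z) * f z ∂m := by
          rw [hM, lintegral_map hw hT.measurable,
            lintegral_withDensity_eq_lintegral_mul₀ hf
              (g := fun z => w (T z)) (hw.comp hT.measurable).aemeasurable]
          simp only [Pi.mul_apply, mul_comm]
  · calc ∫ ξ, ((M.rnDeriv volume ξ).toReal : ℂ) * u ξ = ∫ ξ, u ξ ∂M := by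
          conv_rhs => rw [← hMd]
          rw [integral_withDensity_eq_integral_toReal_smul (Measure.measurable_rnDeriv _ _)
            (Measure.rnDeriv_lt_top _ _)]
          rfl
      _ = ∫ z, ((f z).toReal : ℂ) * u (T z) ∂m := by
          rw [hM, integral_map hT.measurable.aemeasurable hu.aestronglyMeasurable,
            integral_withDensity_eq_integral_toReal_smul₀ hf hlt]
          rfl

lemma integral_sub_add_I_mul_sub {f₁ f₂ f₃ f₄ : Z → ℂ} (h₁ : Integrable f₁ m)
    (h₂ : Integrable f₂ m) (h₃ : Integrable f₃ m) (h₄ : Integrable f₄ m) :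
    ∫ z, (f₁ z - f₂ z + Complex.I * (f₃ z - f₄ z)) ∂m =
      ∫ z, f₁ z ∂m - ∫ z, f₂ z ∂m + Complex.I * (∫ z, f₃ z ∂m - ∫ z, f₄ z ∂m) := by
  rw [← integral_sub h₁ h₂, ← integral_sub h₃ h₄, ← integral_const_mul]
  exact integral_add (h₁.sub h₂) ((h₃.sub h₄).const_mul _)

/-- The push-forward of an integrable complex density under a map that does not charge null sets
is again given by a density. -/
lemma exists_fourier_density (hT : Measure.QuasiMeasurePreserving T m volume)
    {c : Z → ℂ} (hc : Integrable c m) :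
    ∃ H : ℝ → ℂ, Integrable H ∧
      (∀ w : ℝ → ℝ≥0∞, Measurable w →
        ∫⁻ ξ, w ξ * ‖H ξ‖ₑ ≤ 4 * ∫⁻ z, w (T z) * ‖c z‖ₑ ∂m) ∧
      ∀ x : ℝ, ∫ ξ : ℝ, H ξ * Complex.exp (Complex.I * x * ξ) =
        ∫ z, c z * Complex.exp (Complex.I * x * T z) ∂m := by
  -- The amplitude is split into the positive and negative parts of its real and imaginary parts,
  -- each dominated by `‖c‖`; these four pieces account for the constant `4`.
  have key : ∀ r : Z → ℝ, Integrable r m → (∀ z, |r z| ≤ ‖c z‖) →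
      ∃ h : ℝ → ℝ≥0∞, Measurable h ∧ (∫⁻ ξ, h ξ ≠ ⊤) ∧
      (∀ w : ℝ → ℝ≥0∞, Measurable w → ∫⁻ ξ, w ξ * h ξ ≤ ∫⁻ z, w (T z) * ‖c z‖ₑ ∂m) ∧
      ∀ u : ℝ → ℂ, Measurable u →
        ∫ ξ, ((h ξ).toReal : ℂ) * u ξ = ∫ z, (max (r z) 0 : ℝ) * u (T z) ∂m := by
    intro r hr hrc
    have hle : ∀ z, ENNReal.ofReal (r z) ≤ ‖c z‖ₑ := fun z => by
      rw [← ofReal_norm]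
      exact ENNReal.ofReal_le_ofReal ((le_abs_self _).trans (hrc z))
    have hfi : ∫⁻ z, ENNReal.ofReal (r z) ∂m ≠ ⊤ :=
      ((lintegral_mono hle).trans_lt hc.hasFiniteIntegral).ne
    obtain ⟨h, h1, h2, h3, h4⟩ := exists_lintegral_density hT hr.aemeasurable.ennreal_ofReal hfi
    refine ⟨h, h1, h2, fun w hw => ?_, fun u hu => ?_⟩
    · rw [h3 w hw]
      exact lintegral_mono fun z => by gcongr; exact hle z
    · rw [h4 u hu]
      simp only [ENNReal.toReal_ofReal']
  have hre : ∀ z, |(c z).re| ≤ ‖c z‖ := fun z => Complex.abs_re_le_norm _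
  have him : ∀ z, |(c z).im| ≤ ‖c z‖ := fun z => Complex.abs_im_le_norm _
  obtain ⟨h₁, m₁, i₁, w₁, u₁⟩ := key (fun z => (c z).re) hc.re hre
  obtain ⟨h₂, m₂, i₂, w₂, u₂⟩ := key (fun z => -(c z).re) hc.re.neg fun z => by
    rw [abs_neg]; exact hre z
  obtain ⟨h₃, m₃, i₃, w₃, u₃⟩ := key (fun z => (c z).im) hc.im him
  obtain ⟨h₄, m₄, i₄, w₄, u₄⟩ := key (fun z => -(c z).im) hc.im.neg fun z => by
    rw [abs_neg]; exact him z
  have hint : ∀ h : ℝ → ℝ≥0∞, Measurable h → (∫⁻ ξ, h ξ ≠ ⊤) →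
      Integrable (fun ξ => ((h ξ).toReal : ℂ)) := fun h hm hi =>
    (integrable_toReal_of_lintegral_ne_top hm.aemeasurable hi).ofReal
  have hnorm : ∀ t : ℝ≥0∞, ‖((t.toReal : ℝ) : ℂ)‖ₑ ≤ t := fun t => by
    rw [← ofReal_norm, Complex.norm_real, Real.norm_of_nonneg ENNReal.toReal_nonneg]
    exact ENNReal.ofReal_toReal_le
  refine ⟨fun ξ => ((h₁ ξ).toReal : ℂ) - (h₂ ξ).toReal +
    Complex.I * ((h₃ ξ).toReal - (h₄ ξ).toReal), ?_, fun w hw => ?_, fun x => ?_⟩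
  · exact ((hint _ m₁ i₁).sub (hint _ m₂ i₂)).add
      (((hint _ m₃ i₃).sub (hint _ m₄ i₄)).const_mul _)
  · calc _ ≤ ∫⁻ ξ, (w ξ * h₁ ξ + w ξ * h₂ ξ + (w ξ * h₃ ξ + w ξ * h₄ ξ)) := by
          refine lintegral_mono fun ξ => ?_
          simp only [← mul_add]
          gcongr
          refine (enorm_add_le _ _).trans (add_le_add ?_ ?_)
          · exact (enorm_sub_le).trans (add_le_add (hnorm _) (hnorm _))
          · rw [enorm_mul]
            have : ‖Complex.I‖ₑ = 1 := by rw [← ofReal_norm, Complex.norm_I]; simp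
            rw [this, one_mul]
            exact (enorm_sub_le).trans (add_le_add (hnorm _) (hnorm _))
      _ = (∫⁻ ξ, w ξ * h₁ ξ) + (∫⁻ ξ, w ξ * h₂ ξ) +
            ((∫⁻ ξ, w ξ * h₃ ξ) + ∫⁻ ξ, w ξ * h₄ ξ) := by
          have a₁ : Measurable fun ξ => w ξ * h₁ ξ := hw.mul m₁
          have a₂ : Measurable fun ξ => w ξ * h₂ ξ := hw.mul m₂
          have a₃ : Measurable fun ξ => w ξ * h₃ ξ := hw.mul m₃
          have a₁₂ : Measurable fun ξ => w ξ * h₁ ξ + w ξ * h₂ ξ := a₁.add a₂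
          rw [lintegral_add_left a₁₂, lintegral_add_left a₁, lintegral_add_left a₃]
      _ ≤ _ := by
          refine (add_le_add (add_le_add (w₁ w hw) (w₂ w hw))
            (add_le_add (w₃ w hw) (w₄ w hw))).trans_eq ?_
          ring
  · set u : ℝ → ℂ := fun ξ => Complex.exp (Complex.I * x * ξ) with hu
    have hum : Measurable u := Continuous.measurable (by fun_prop)
    have hu1 : ∀ ξ, ‖u ξ‖ ≤ 1 := fun ξ => (norm_exp_I_mul_mul x ξ).le
    have hI : ∀ h : ℝ → ℝ≥0∞, Measurable h → (∫⁻ ξ, h ξ ≠ ⊤) →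
        Integrable (fun ξ => ((h ξ).toReal : ℂ) * u ξ) := fun h hm hi =>
      (hint h hm hi).mul_bdd (c := 1) hum.aestronglyMeasurable (Eventually.of_forall hu1)
    have hJ : ∀ r : Z → ℝ, Integrable r m →
        Integrable (fun z => ((max (r z) 0 : ℝ) : ℂ) * u (T z)) m := fun r hr =>
      (hr.pos_part.ofReal (𝕜 := ℂ)).mul_bdd (c := 1)
        (hum.comp hT.measurable).aestronglyMeasurable (Eventually.of_forall fun z => hu1 _)
    calc ∫ ξ : ℝ, (((h₁ ξ).toReal : ℂ) - (h₂ ξ).toReal +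
          Complex.I * ((h₃ ξ).toReal - (h₄ ξ).toReal)) * u ξ
        = ∫ ξ : ℝ, (((h₁ ξ).toReal : ℂ) * u ξ - (h₂ ξ).toReal * u ξ) +
          Complex.I * ((h₃ ξ).toReal * u ξ - (h₄ ξ).toReal * u ξ) := by
          refine integral_congr_ae (Eventually.of_forall fun ξ => ?_)
          simp only; ring
      _ = ∫ z, ((max (c z).re 0 : ℝ) : ℂ) * u (T z) ∂m - ∫ z, (max (-(c z).re) 0 : ℝ) * u (T z) ∂m
          + Complex.I * (∫ z, ((max (c z).im 0 : ℝ) : ℂ) * u (T z) ∂m -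
            ∫ z, ((max (-(c z).im) 0 : ℝ) : ℂ) * u (T z) ∂m) := by
          rw [integral_sub_add_I_mul_sub (hI _ m₁ i₁) (hI _ m₂ i₂) (hI _ m₃ i₃) (hI _ m₄ i₄),
            u₁ u hum, u₂ u hum, u₃ u hum, u₄ u hum]
      _ = ∫ z, c z * u (T z) ∂m := by
          have j₁ := hJ _ hc.re
          have j₂ := hJ _ hc.re.neg
          have j₃ := hJ _ hc.im
          have j₄ := hJ _ hc.im.neg
          simp only [Pi.neg_apply, RCLike.re_to_complex, RCLike.im_to_complex] at j₁ j₂ j₃ j₄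
          rw [← integral_sub_add_I_mul_sub j₁ j₂ j₃ j₄]
          refine integral_congr_ae (Eventually.of_forall fun z => ?_)
          have e : ∀ t : ℝ, ((max t 0 : ℝ) : ℂ) - ((max (-t) 0 : ℝ) : ℂ) = t := fun t => by
            rw [← Complex.ofReal_sub, max_zero_sub_max_neg_zero_eq_self]
          simp only
          rw [← sub_mul, ← sub_mul, e, e, ← mul_assoc, ← add_mul, mul_comm Complex.I,
            Complex.re_add_im]

end Pushforward

/-! ### Sums of frequencies, product integrals and the tamed weight -/

/-- For fixed second variable the map is a translate of `ξ`, so each slice of the preimage of a null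
set is null by translation invariance. -/
lemma quasiMeasurePreserving_add {X Y : Type*} [MeasurableSpace X] [MeasurableSpace Y]
    {μ : Measure X} {ν : Measure Y} [SFinite μ] [SFinite ν] {ξ : X → ℝ} {t : Y → ℝ}
    (hξ : Measure.QuasiMeasurePreserving ξ μ volume) (ht : Measurable t) :
    Measure.QuasiMeasurePreserving (fun z : X × Y => ξ z.1 + t z.2) (μ.prod ν) volume := by
  have hm : Measurable fun z : X × Y => ξ z.1 + t z.2 :=
    (hξ.measurable.comp measurable_fst).add (ht.comp measurable_snd)
  refine ⟨hm, Measure.AbsolutelyContinuous.mk fun s hs hs0 => ?_⟩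
  rw [Measure.map_apply hm hs, Measure.prod_apply_symm (hm hs)]
  refine (lintegral_eq_zero_iff' ?_).2 (Eventually.of_forall fun y => ?_)
  · exact (measurable_measure_prodMk_right (hm hs)).aemeasurable
  · have : (fun x => (x, y)) ⁻¹' ((fun z : X × Y => ξ z.1 + t z.2) ⁻¹' s) =
        ξ ⁻¹' ((fun r => r + t y) ⁻¹' s) := rfl
    simp only [Pi.zero_apply]
    rw [this]
    exact hξ.preimage_null (by rw [measure_preimage_add_right]; exact hs0)

lemma lintegral_fin_prod_eq_prod {X : Type*} [MeasurableSpace X] {μ : Measure X} [SigmaFinite μ]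
    {n : ℕ} {f : Fin n → X → ℝ≥0∞} (hf : ∀ i, AEMeasurable (f i) μ) :
    ∫⁻ z : Fin n → X, ∏ i, f i (z i) ∂(Measure.pi fun _ => μ) = ∏ i, ∫⁻ p, f i p ∂μ := by
  induction n with
  | zero => simp
  | succ n ih =>
    have h := (measurePreserving_piFinSuccAbove (fun _ : Fin (n + 1) => μ) 0).symm
    rw [← h.lintegral_comp_emb (MeasurableEquiv.measurableEmbedding _)]
    have hm : AEMeasurable (fun z : Fin n → X => ∏ i : Fin n, f i.succ (z i))
        (Measure.pi fun _ => μ) :=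
      Finset.aemeasurable_fun_prod _ fun i _ => (hf i.succ).comp_quasiMeasurePreserving
        (Measure.quasiMeasurePreserving_eval (μ := fun _ : Fin n => μ) i)
    simp_rw [MeasurableEquiv.piFinSuccAbove_symm_apply, Fin.insertNthEquiv,
      Fin.prod_univ_succ, Fin.insertNth_zero]
    simp only [Equiv.coe_fn_mk, Fin.cons_succ, Fin.cons_zero, cast_eq]
    rw [lintegral_prod_mul (hf 0) hm, ih fun i => hf i.succ]

/-- The weight `|ξ|^s min(1, |ξ|)`. -/
def tamedWeight (s ξ : ℝ) : ℝ := |ξ| ^ s * min 1 |ξ|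

lemma tamedWeight_nonneg (s ξ : ℝ) : 0 ≤ tamedWeight s ξ := by
  unfold tamedWeight; positivity

lemma measurable_tamedWeight (s : ℝ) : Measurable (tamedWeight s) := by
  unfold tamedWeight
  exact (measurable_id.abs.pow_const s).mul (measurable_const.min measurable_id.abs)

/-- Both factors are charged to the same index, that of the largest `|t i|`: the power costs `N ^ s`
and the minimum costs `N`. -/
lemma abs_sum_rpow_mul_min_le {N : ℕ} [NeZero N] {s : ℝ} (hs : 0 ≤ s) (t : Fin N → ℝ) {E : ℝ}
    (hE : |E| ≤ ∑ i, |t i|) :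
    |∑ i, t i| ^ s * min 1 |E| ≤ (N : ℝ) ^ (s + 1) * ∑ i, tamedWeight s (t i) := by
  obtain ⟨M, -, hM⟩ := Finset.exists_max_image (Finset.univ : Finset (Fin N)) (fun i => |t i|)
    ⟨0, Finset.mem_univ _⟩
  have hN : (1 : ℝ) ≤ N := by exact_mod_cast NeZero.one_le
  have hsum : ∑ i, |t i| ≤ N * |t M| := by
    refine (Finset.sum_le_card_nsmul _ _ _ hM).trans_eq ?_
    simp
  have h1 : |∑ i, t i| ^ s ≤ (N : ℝ) ^ s * |t M| ^ s := by
    rw [← Real.mul_rpow (by positivity) (abs_nonneg _)]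
    exact Real.rpow_le_rpow (abs_nonneg _) ((Finset.abs_sum_le_sum_abs _ _).trans hsum) hs
  have h2 : min 1 |E| ≤ N * min 1 |t M| := by
    rw [mul_min_of_nonneg _ _ (by positivity), mul_one]
    exact min_le_min hN (hE.trans hsum)
  calc |∑ i, t i| ^ s * min 1 |E| ≤ ((N : ℝ) ^ s * |t M| ^ s) * (N * min 1 |t M|) := by
        gcongr
    _ = (N : ℝ) ^ (s + 1) * tamedWeight s (t M) := by
        rw [Real.rpow_add_one (by positivity), tamedWeight]; ring
    _ ≤ _ := by
        gcongr
        exact Finset.single_le_sum (f := fun i => tamedWeight s (t i))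
          (fun i _ => tamedWeight_nonneg s _) (Finset.mem_univ M)

/-! ### Superpositions of plane waves and their products -/

/-- A superposition of plane waves `exp (i (x ξ - y e))` with amplitudes `a`, indexed by a measure
space. -/
structure WaveData {X : Type*} [MeasurableSpace X] (μ : Measure X) where
  /-- the frequency in `x` -/
  freq : X → ℝ
  /-- the frequency in `y` -/
  shift : X → ℝ
  /-- the amplitude -/
  amp : X → ℂ
  qmp_freq : Measure.QuasiMeasurePreserving freq μ volume
  measurable_shift : Measurable shift
  abs_shift_le : ∀ p, |shift p| ≤ |freq p|
  integrable_amp : Integrable amp μ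
  integrable_freq_mul_amp : Integrable (fun p => (freq p : ℂ) * amp p) μ

namespace WaveData

variable {X : Type*} [MeasurableSpace X] {μ : Measure X} (W : WaveData μ)

/-- The phase factor of a single wave. -/
def phase (x y : ℝ) (p : X) : ℂ :=
  Complex.exp (Complex.I * x * W.freq p) * Complex.exp (-(Complex.I * y * W.shift p))

lemma norm_phase (x y : ℝ) (p : X) : ‖W.phase x y p‖ = 1 := by
  rw [phase, norm_mul, norm_exp_I_mul_mul, norm_exp_neg_I_mul_mul, one_mul]

lemma measurable_freq : Measurable W.freq := W.qmp_freq.measurable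

lemma measurable_phase (x y : ℝ) : Measurable (W.phase x y) := by
  have := W.measurable_freq
  have := W.measurable_shift
  unfold phase
  fun_prop

/-- The superposition of the waves. -/
def wave (x y : ℝ) : ℂ := ∫ p, W.amp p * W.phase x y p ∂μ

/-- The amplitude of the derivative of the superposition in `x`. -/
def derivAmp (p : X) : ℂ := Complex.I * (W.freq p * W.amp p)

/-- The derivative of the superposition in `x`. -/
def waveDeriv (x y : ℝ) : ℂ := ∫ p, W.derivAmp p * W.phase x y p ∂μ

lemma integrable_derivAmp : Integrable W.derivAmp μ := W.integrable_freq_mul_amp.const_mul _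

lemma norm_derivAmp (p : X) : ‖W.derivAmp p‖ = |W.freq p| * ‖W.amp p‖ := by
  rw [derivAmp, norm_mul, norm_mul, Complex.norm_I, one_mul, Complex.norm_real, Real.norm_eq_abs]

lemma norm_integral_phase_le (f : X → ℂ) (x y : ℝ) :
    ‖∫ p, f p * W.phase x y p ∂μ‖ ≤ ∫ p, ‖f p‖ ∂μ := by
  refine (norm_integral_le_integral_norm _).trans_eq ?_
  simp_rw [norm_mul, W.norm_phase, mul_one]

lemma integrable_mul_phase {f : X → ℂ} (hf : Integrable f μ) (x y : ℝ) :
    Integrable (fun p => f p * W.phase x y p) μ :=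
  hf.mul_bdd (c := 1) (W.measurable_phase x y).aestronglyMeasurable
    (Eventually.of_forall fun p => (W.norm_phase x y p).le)

lemma continuous_integral_phase {f : X → ℂ} (hf : Integrable f μ) (x : ℝ) :
    Continuous fun y => ∫ p, f p * W.phase x y p ∂μ := by
  refine continuous_of_dominated (bound := fun p => ‖f p‖) ?_ ?_ hf.norm ?_
  · exact fun y => (W.integrable_mul_phase hf x y).aestronglyMeasurable
  · exact fun y => Eventually.of_forall fun p => by rw [norm_mul, W.norm_phase, mul_one]
  · exact Eventually.of_forall fun p => by unfold phase; fun_prop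

lemma hasDerivAt_wave (x y : ℝ) : HasDerivAt (fun x => W.wave x y) (W.waveDeriv x y) x := by
  refine (hasDerivAt_integral_of_dominated_loc_of_deriv_le (s := Set.univ) (𝕜 := ℝ) (E := ℂ)
    (F := fun t p => W.amp p * W.phase t y p) (F' := fun t p => W.derivAmp p * W.phase t y p)
    (bound := fun p => ‖W.derivAmp p‖) univ_mem ?_ ?_ ?_ ?_ W.integrable_derivAmp.norm ?_).2
  · exact Eventually.of_forall fun t =>
      (W.integrable_mul_phase W.integrable_amp t y).aestronglyMeasurable
  · exact W.integrable_mul_phase W.integrable_amp x y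
  · exact (W.integrable_mul_phase W.integrable_derivAmp x y).aestronglyMeasurable
  · exact Eventually.of_forall fun p t _ => by rw [norm_mul, W.norm_phase, mul_one]
  · refine Eventually.of_forall fun p t _ => ?_
    have h1 : HasDerivAt (fun t : ℝ => Complex.I * t * W.freq p) (Complex.I * 1 * W.freq p) t :=
      ((Complex.ofRealCLM.hasDerivAt (x := t)).const_mul Complex.I).mul_const _
    refine ((h1.cexp.mul_const (Complex.exp (-(Complex.I * y * W.shift p)))).const_mul
      (W.amp p)).congr_deriv ?_
    rw [derivAmp, phase]
    ring

/-- The frequency in `x` of a product of `m + 2` waves. -/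
def totalFreq (m : ℕ) (z : X × (Fin (m + 1) → X)) : ℝ :=
  W.freq z.1 + ∑ i, W.freq (z.2 i)

/-- The frequency in `y` of a product of `m + 2` waves. -/
def totalShift (m : ℕ) (z : X × (Fin (m + 1) → X)) : ℝ :=
  W.shift z.1 + ∑ i, W.shift (z.2 i)

/-- The amplitude of a product of `m + 2` waves, the first of which is differentiated. -/
def totalAmp (m : ℕ) (z : X × (Fin (m + 1) → X)) : ℂ :=
  W.derivAmp z.1 * ∏ i, W.amp (z.2 i)

lemma measurable_totalFreq (m : ℕ) : Measurable (W.totalFreq m) := by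
  have := W.measurable_freq
  unfold totalFreq
  fun_prop

lemma measurable_totalShift (m : ℕ) : Measurable (W.totalShift m) := by
  have := W.measurable_shift
  unfold totalShift
  fun_prop

lemma aemeasurable_enorm_amp : AEMeasurable (fun p => ‖W.amp p‖ₑ) μ :=
  W.integrable_amp.aestronglyMeasurable.enorm

lemma enorm_derivAmp (p : X) : ‖W.derivAmp p‖ₑ = ENNReal.ofReal |W.freq p| * ‖W.amp p‖ₑ := by
  rw [← ofReal_norm, norm_derivAmp, ENNReal.ofReal_mul (abs_nonneg _), ofReal_norm]

lemma enorm_totalAmp (m : ℕ) (z : X × (Fin (m + 1) → X)) :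
    ‖W.totalAmp m z‖ₑ = ‖W.derivAmp z.1‖ₑ * ∏ i, ‖W.amp (z.2 i)‖ₑ := by
  rw [totalAmp, enorm_mul]
  congr 1
  simp only [← ofReal_norm, norm_prod]
  exact ENNReal.ofReal_prod_of_nonneg fun i _ => norm_nonneg _

lemma rpow_totalFreq_mul_min_le {s : ℝ} (hs : 0 ≤ s) (m : ℕ) (z : X × (Fin (m + 1) → X)) :
    |W.totalFreq m z| ^ s * min 1 |W.totalShift m z| ≤
      ((m : ℝ) + 2) ^ (s + 1) *
        (tamedWeight s (W.freq z.1) + ∑ i, tamedWeight s (W.freq (z.2 i))) := by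
  -- The tuple consists of the differentiated wave followed by the `m + 1` others.
  have h := abs_sum_rpow_mul_min_le (N := m + 2) hs
    (Fin.cons (W.freq z.1) fun i => W.freq (z.2 i)) (E := W.totalShift m z) (by
      rw [Fin.sum_univ_succ]
      simp only [Fin.cons_zero, Fin.cons_succ]
      refine (abs_add_le _ _).trans (add_le_add (W.abs_shift_le _) ?_)
      exact (Finset.abs_sum_le_sum_abs _ _).trans (Finset.sum_le_sum fun i _ => W.abs_shift_le _))
  simp only [Fin.sum_univ_succ (n := m + 1), Fin.cons_zero, Fin.cons_succ] at h
  push_cast at h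
  exact h

lemma aemeasurable_ofReal_mul_enorm_amp {w : ℝ → ℝ} (hw : Measurable w) :
    AEMeasurable (fun p => ENNReal.ofReal (w (W.freq p)) * ‖W.amp p‖ₑ) μ :=
  (hw.comp W.measurable_freq).ennreal_ofReal.aemeasurable.mul W.aemeasurable_enorm_amp

variable (μ) in
/-- The measure on tuples of waves. -/
abbrev tupleMeasure (m : ℕ) : Measure (X × (Fin (m + 1) → X)) :=
  μ.prod (Measure.pi fun _ => μ)

variable [SigmaFinite μ]

lemma integrable_totalAmp (m : ℕ) : Integrable (W.totalAmp m) (tupleMeasure μ m) :=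
  W.integrable_derivAmp.mul_prod (Integrable.fintype_prod fun _ => W.integrable_amp)

lemma qmp_totalFreq (m : ℕ) :
    Measure.QuasiMeasurePreserving (W.totalFreq m) (tupleMeasure μ m) volume := by
  have := W.measurable_freq
  exact quasiMeasurePreserving_add (t := fun z : Fin (m + 1) → X => ∑ i, W.freq (z i))
    W.qmp_freq (by fun_prop)

/-- A product of integrals is an integral over tuples, in which phases multiply and so frequencies
and shifts add. -/
lemma waveDeriv_mul_wave_pow (m : ℕ) (x y : ℝ) :
    W.waveDeriv x y * W.wave x y ^ (m + 1) =
      ∫ z, W.totalAmp m z * (Complex.exp (Complex.I * x * W.totalFreq m z) *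
        Complex.exp (-(Complex.I * y * W.totalShift m z))) ∂(tupleMeasure μ m) := by
  have h := integral_fintype_prod_eq_pow (ι := Fin (m + 1)) (μ := μ)
    (fun p => W.amp p * W.phase x y p)
  rw [Fintype.card_fin] at h
  rw [wave, ← h, waveDeriv, ← integral_prod_mul]
  refine integral_congr_ae (Eventually.of_forall fun z => ?_)
  simp only [phase, totalAmp, totalFreq, totalShift, Finset.prod_mul_distrib, ← Complex.exp_sum,
    Complex.ofReal_add, Complex.ofReal_sum, mul_add, Finset.mul_sum, neg_add, Complex.exp_add,
    Finset.sum_neg_distrib]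
  ring

lemma continuous_fourierInt {φ : ℝ → ℂ} (hφ : Integrable φ) : Continuous (fourierInt φ) := by
  refine continuous_of_dominated (bound := fun y => ‖φ y‖) ?_ ?_ hφ.norm ?_
  · exact fun E => (integrable_mul_exp_neg hφ E).aestronglyMeasurable
  · exact fun E => Eventually.of_forall fun p => by
      rw [norm_mul, norm_exp_neg_I_mul_mul, mul_one]
  · exact Eventually.of_forall fun p => by fun_prop

/-- The amplitude of the `m`-th term of the expansion after integration in `y`. -/
def termAmp (D : ℝ) (m : ℕ) (z : X × (Fin (m + 1) → X)) : ℂ :=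
  W.totalAmp m z * kernHat D m (W.totalShift m z)

lemma integrable_termAmp {D : ℝ} (hD : D ≠ 0) (m : ℕ) :
    Integrable (W.termAmp D m) (tupleMeasure μ m) := by
  have hk : Integrable (fun y => (kern D m y : ℂ)) := (integrable_kern hD m).ofReal
  exact (W.integrable_totalAmp m).mul_bdd
    ((continuous_fourierInt hk).measurable.comp (W.measurable_totalShift m)).aestronglyMeasurable
    (Eventually.of_forall fun z => norm_fourierInt_le _ _)

/-- In each tuple `y` enters only through the kernel and `exp (-iyE)`, so Fubini leaves `kernHat D m
E`. -/
lemma integral_kern_mul {D : ℝ} (hD : D ≠ 0) (m : ℕ) (x : ℝ) :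
    ∫ y, (kern D m y : ℂ) * (W.waveDeriv x y * W.wave x y ^ (m + 1)) =
      ∫ z, W.termAmp D m z * Complex.exp (Complex.I * x * W.totalFreq m z)
        ∂(tupleMeasure μ m) := by
  have hk : Integrable (fun y => (kern D m y : ℂ)) := (integrable_kern hD m).ofReal
  have hT := W.measurable_totalFreq m
  have hE := W.measurable_totalShift m
  simp_rw [W.waveDeriv_mul_wave_pow, ← integral_const_mul]
  rw [integral_integral_swap]
  · refine integral_congr_ae (Eventually.of_forall fun z => ?_)
    simp only [termAmp, kernHat, fourierInt]
    rw [← integral_const_mul, ← integral_mul_const]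
    refine integral_congr_ae (Eventually.of_forall fun y => ?_)
    simp only
    ring
  · refine (hk.mul_prod (W.integrable_totalAmp m)).mul_bdd (c := 1)
      (g := fun q : ℝ × (X × (Fin (m + 1) → X)) =>
        Complex.exp (Complex.I * x * W.totalFreq m q.2) *
        Complex.exp (-(Complex.I * q.1 * W.totalShift m q.2)))
      (Measurable.aestronglyMeasurable (by fun_prop)) (Eventually.of_forall fun q => ?_)
      |>.congr (Eventually.of_forall fun q => ?_)
    · rw [norm_mul, norm_exp_I_mul_mul, norm_exp_neg_I_mul_mul, one_mul]
    · simp only [Function.uncurry]; ring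

/-- The mass `∫ w(ξ) |a|` of the amplitude with respect to a weight in the frequency. -/
def mass (w : ℝ → ℝ) : ℝ≥0∞ := ∫⁻ p, ENNReal.ofReal (w (W.freq p)) * ‖W.amp p‖ₑ ∂μ

lemma lintegral_tuple_mul {u : X → ℝ≥0∞} {m : ℕ} {f : Fin (m + 1) → X → ℝ≥0∞}
    (hu : AEMeasurable u μ) (hf : ∀ i, AEMeasurable (f i) μ) :
    ∫⁻ z, u z.1 * ∏ i, f i (z.2 i) ∂(tupleMeasure μ m) =
      (∫⁻ p, u p ∂μ) * ∏ i, ∫⁻ p, f i p ∂μ := by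
  rw [lintegral_prod_mul (g := fun z : Fin (m + 1) → X => ∏ i, f i (z i)) hu,
    lintegral_fin_prod_eq_prod hf]
  exact Finset.aemeasurable_fun_prod _ fun i _ => (hf i).comp_quasiMeasurePreserving
    (Measure.quasiMeasurePreserving_eval (μ := fun _ : Fin (m + 1) => μ) i)

/-- Weight on the differentiated wave: it combines with the factor `|ξ|` of the derivative. Source
of the `F_1` part of the estimate. -/
lemma lintegral_tuple_first {w : ℝ → ℝ} (hw : Measurable w) (m : ℕ) :
    ∫⁻ z, ENNReal.ofReal (w (W.freq z.1)) * ‖W.totalAmp m z‖ₑ ∂(tupleMeasure μ m) =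
      W.mass (fun ξ => w ξ * |ξ|) * W.mass (fun _ => 1) ^ (m + 1) := by
  have h := lintegral_tuple_mul (μ := μ) (m := m)
    (W.aemeasurable_ofReal_mul_enorm_amp (hw.mul measurable_id.abs))
    fun _ => W.aemeasurable_enorm_amp
  simp only [Finset.prod_const, Finset.card_univ, Fintype.card_fin] at h
  simp only [mass, ENNReal.ofReal_one, one_mul]
  refine Eq.trans ?_ h
  refine lintegral_congr fun z => ?_
  rw [enorm_totalAmp, enorm_derivAmp]
  simp only [Pi.mul_apply, id, ENNReal.ofReal_mul' (abs_nonneg _)]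
  ring

/-- Weight on an undifferentiated wave: the derivative stays behind as a separate factor. Source of
the `F_2` part. -/
lemma lintegral_tuple_rest {w : ℝ → ℝ} (hw : Measurable w) (m : ℕ) (i : Fin (m + 1)) :
    ∫⁻ z, ENNReal.ofReal (w (W.freq (z.2 i))) * ‖W.totalAmp m z‖ₑ ∂(tupleMeasure μ m) =
      W.mass (fun ξ => |ξ|) * (W.mass w * W.mass (fun _ => 1) ^ m) := by
  have h := lintegral_tuple_mul (μ := μ) (m := m) (u := fun p => ‖W.derivAmp p‖ₑ)
    (f := fun j p => (if j = i then ENNReal.ofReal (w (W.freq p)) else 1) * ‖W.amp p‖ₑ)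
    W.integrable_derivAmp.aestronglyMeasurable.enorm fun j => by
      by_cases hj : j = i
      · simpa only [hj, if_true] using W.aemeasurable_ofReal_mul_enorm_amp hw
      · simpa only [hj, if_false, one_mul] using W.aemeasurable_enorm_amp
  rw [← Finset.mul_prod_erase _ _ (Finset.mem_univ i)] at h
  rw [Finset.prod_congr (g := fun _ => W.mass fun _ => 1) rfl fun j hj => by
    simp [Finset.ne_of_mem_erase hj, mass]] at h
  simp only [Finset.prod_const, Finset.card_erase_of_mem (Finset.mem_univ i), Finset.card_univ,
    Fintype.card_fin, Nat.add_sub_cancel, if_true, enorm_derivAmp] at h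
  refine Eq.trans ?_ h
  refine lintegral_congr fun z => ?_
  rw [enorm_totalAmp, enorm_derivAmp, Finset.prod_mul_distrib, Finset.prod_ite_eq' Finset.univ i,
    if_pos (Finset.mem_univ i)]
  ring

lemma enorm_kernHat_le {D : ℝ} (hD : D ≠ 0) (m : ℕ) (E : ℝ) :
    ‖kernHat D m E‖ₑ ≤
      ENNReal.ofReal ((1 + |D|) * poissonMass D * |D|⁻¹ ^ m) * ENNReal.ofReal (min 1 |E|) := by
  have := poissonMass_nonneg D
  rw [← ofReal_norm, ← ENNReal.ofReal_mul (by positivity)]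
  exact ENNReal.ofReal_le_ofReal (norm_kernHat_le hD m E)

/-- The weighted bound for the amplitude of the `m`-th term. -/
lemma lintegral_rpow_mul_termAmp_le {D s : ℝ} (hD : D ≠ 0) (hs : 0 ≤ s) (m : ℕ) :
    ∫⁻ z, ENNReal.ofReal (|W.totalFreq m z| ^ s) * ‖W.termAmp D m z‖ₑ ∂(tupleMeasure μ m) ≤
      ENNReal.ofReal ((1 + |D|) * poissonMass D * |D|⁻¹ ^ m * ((m : ℝ) + 2) ^ (s + 1)) *
        (W.mass (fun ξ => tamedWeight s ξ * |ξ|) * W.mass (fun _ => 1) ^ (m + 1) +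
          (m + 1) * (W.mass (fun ξ => |ξ|) *
            (W.mass (tamedWeight s) * W.mass (fun _ => 1) ^ m))) := by
  have hJ := poissonMass_nonneg D
  have hw := measurable_tamedWeight s
  have hae : ∀ u : X × (Fin (m + 1) → X) → ℝ, Measurable u →
      AEMeasurable (fun z => ENNReal.ofReal (tamedWeight s (u z)) * ‖W.totalAmp m z‖ₑ)
        (tupleMeasure μ m) := fun u hu =>
    (hw.comp hu).ennreal_ofReal.aemeasurable.mul
      (W.integrable_totalAmp m).aestronglyMeasurable.enorm
  have hf := W.measurable_freq
  calc _ ≤ ∫⁻ z, ENNReal.ofReal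
          ((1 + |D|) * poissonMass D * |D|⁻¹ ^ m * ((m : ℝ) + 2) ^ (s + 1)) *
          (ENNReal.ofReal (tamedWeight s (W.freq z.1)) * ‖W.totalAmp m z‖ₑ +
            ∑ i, ENNReal.ofReal (tamedWeight s (W.freq (z.2 i))) * ‖W.totalAmp m z‖ₑ)
          ∂(tupleMeasure μ m) := by
        refine lintegral_mono fun z => ?_
        have hS : 0 ≤ ∑ i, tamedWeight s (W.freq (z.2 i)) :=
          Finset.sum_nonneg fun i _ => tamedWeight_nonneg _ _
        have key : ENNReal.ofReal (|W.totalFreq m z| ^ s) * ‖kernHat D m (W.totalShift m z)‖ₑ ≤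
            ENNReal.ofReal ((1 + |D|) * poissonMass D * |D|⁻¹ ^ m * ((m : ℝ) + 2) ^ (s + 1)) *
              ENNReal.ofReal (tamedWeight s (W.freq z.1) +
                ∑ i, tamedWeight s (W.freq (z.2 i))) := by
          refine (mul_le_mul_right (enorm_kernHat_le hD m _) _).trans ?_
          rw [mul_left_comm, ← ENNReal.ofReal_mul (by positivity),
            ← ENNReal.ofReal_mul (by positivity), ← ENNReal.ofReal_mul (by positivity)]
          refine ENNReal.ofReal_le_ofReal ?_
          rw [mul_assoc _ (((m : ℝ) + 2) ^ (s + 1))]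
          exact mul_le_mul_of_nonneg_left (W.rpow_totalFreq_mul_min_le hs m z) (by positivity)
        rw [termAmp, enorm_mul, ← Finset.sum_mul, ← add_mul,
          ← ENNReal.ofReal_sum_of_nonneg fun i _ => tamedWeight_nonneg _ _,
          ← ENNReal.ofReal_add (tamedWeight_nonneg _ _) hS, mul_left_comm,
          mul_comm ‖W.totalAmp m z‖ₑ, ← mul_assoc]
        exact mul_le_mul_left key _
    _ = _ := by
        rw [lintegral_const_mul' _ _ ENNReal.ofReal_ne_top,
          lintegral_add_left' (hae _ (by fun_prop)),
          lintegral_finsetSum' _ fun i _ => hae _ (by fun_prop), W.lintegral_tuple_first hw]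
        simp only [W.lintegral_tuple_rest hw, Finset.sum_const, Finset.card_univ,
          Fintype.card_fin, nsmul_eq_mul, Nat.cast_add, Nat.cast_one]

end WaveData

/-! ### Summation of the expansion -/

lemma integrable_tsum {f : ℕ → ℝ → ℂ} (hf : ∀ m, Integrable (f m))
    (hsum : ∑' m, ∫⁻ ξ, ‖f m ξ‖ₑ ≠ ⊤) : Integrable fun ξ => ∑' m, f m ξ := by
  refine ⟨(AEMeasurable.tsum fun m => (hf m).aemeasurable).aestronglyMeasurable, ?_⟩
  calc ∫⁻ ξ, ‖∑' m, f m ξ‖ₑ ≤ ∫⁻ ξ, ∑' m, ‖f m ξ‖ₑ :=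
        lintegral_mono fun ξ => enorm_tsum_le_tsum_enorm
    _ = ∑' m, ∫⁻ ξ, ‖f m ξ‖ₑ :=
        lintegral_tsum fun m => (hf m).aestronglyMeasurable.enorm
    _ < ⊤ := hsum.lt_top

lemma lintegral_mul_enorm_tsum_le {f : ℕ → ℝ → ℂ} (hf : ∀ m, Integrable (f m))
    {w : ℝ → ℝ≥0∞} (hw : Measurable w) :
    ∫⁻ ξ, w ξ * ‖∑' m, f m ξ‖ₑ ≤ ∑' m, ∫⁻ ξ, w ξ * ‖f m ξ‖ₑ := by
  rw [← lintegral_tsum (f := fun m ξ => w ξ * ‖f m ξ‖ₑ) fun m =>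
    hw.aemeasurable.mul (hf m).aestronglyMeasurable.enorm]
  refine lintegral_mono fun ξ => ?_
  simp only [ENNReal.tsum_mul_left]
  gcongr
  exact enorm_tsum_le_tsum_enorm

/-- Geometric domination justifies exchanging sum and integral. The space varies with `m` because
the terms live on tuples of growing length. -/
lemma tsum_lintegral_enorm_ne_top {α : ℕ → Type*} [∀ m, MeasurableSpace (α m)]
    {μ : ∀ m, Measure (α m)} {f : ∀ m, α m → ℂ} {A q : ℝ} (hf : ∀ m, Integrable (f m) (μ m))
    (hq : 0 ≤ q) (hq1 : q < 1) (h : ∀ m, ∫ z, ‖f m z‖ ∂(μ m) ≤ A * q ^ m) :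
    ∑' m, ∫⁻ z, ‖f m z‖ₑ ∂(μ m) ≠ ⊤ := by
  have hs : Summable fun m => ∫ z, ‖f m z‖ ∂(μ m) :=
    Summable.of_nonneg_of_le (fun m => integral_nonneg fun _ => norm_nonneg _) h
      ((summable_geometric_of_lt_one hq hq1).mul_left A)
  simp_rw [← fun m => ofReal_integral_norm_eq_lintegral_enorm (hf m)]
  exact hs.tsum_ofReal_ne_top

namespace WaveData

variable {X : Type*} [MeasurableSpace X] {μ : Measure X} (W : WaveData μ)

lemma norm_wave_le (x y : ℝ) : ‖W.wave x y‖ ≤ ∫ p, ‖W.amp p‖ ∂μ :=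
  W.norm_integral_phase_le _ x y

lemma norm_waveDeriv_le (x y : ℝ) : ‖W.waveDeriv x y‖ ≤ ∫ p, ‖W.derivAmp p‖ ∂μ :=
  W.norm_integral_phase_le _ x y

/-- The `m`-th term of the expansion of the integrand. -/
def term (D : ℝ) (m : ℕ) (x y : ℝ) : ℂ :=
  (kern D m y : ℂ) * (W.waveDeriv x y * W.wave x y ^ (m + 1))

lemma norm_term_le (D : ℝ) (m : ℕ) (x y : ℝ) :
    ‖W.term D m x y‖ ≤ |kern D m y| *
      ((∫ p, ‖W.derivAmp p‖ ∂μ) * (∫ p, ‖W.amp p‖ ∂μ) ^ (m + 1)) := by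
  rw [term, norm_mul, norm_mul, norm_pow, Complex.norm_real, Real.norm_eq_abs]
  gcongr
  · exact W.norm_waveDeriv_le x y
  · exact W.norm_wave_le x y

lemma integrable_term {D : ℝ} (hD : D ≠ 0) (m : ℕ) (x : ℝ) : Integrable (W.term D m x) := by
  refine ((integrable_kern hD m).abs.mul_const _).mono' ?_
    (Eventually.of_forall (W.norm_term_le D m x))
  refine Continuous.aestronglyMeasurable ?_
  exact (Complex.continuous_ofReal.comp (continuous_kern hD m)).mul
    ((W.continuous_integral_phase W.integrable_derivAmp x).mul
      ((W.continuous_integral_phase W.integrable_amp x).pow _))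

lemma integral_norm_term_le {D : ℝ} (hD : D ≠ 0) (m : ℕ) (x : ℝ) :
    ∫ y, ‖W.term D m x y‖ ≤
      (poissonMass D * (∫ p, ‖W.derivAmp p‖ ∂μ) * (∫ p, ‖W.amp p‖ ∂μ)) *
        (|D|⁻¹ * ∫ p, ‖W.amp p‖ ∂μ) ^ m := by
  have h0 : 0 ≤ (∫ p, ‖W.derivAmp p‖ ∂μ) * (∫ p, ‖W.amp p‖ ∂μ) ^ (m + 1) := by positivity
  calc ∫ y, ‖W.term D m x y‖ ≤ ∫ y, |kern D m y| *
        ((∫ p, ‖W.derivAmp p‖ ∂μ) * (∫ p, ‖W.amp p‖ ∂μ) ^ (m + 1)) :=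
        integral_mono (W.integrable_term hD m x).norm ((integrable_kern hD m).abs.mul_const _)
          (W.norm_term_le D m x)
    _ ≤ (|D|⁻¹ ^ m * poissonMass D) *
        ((∫ p, ‖W.derivAmp p‖ ∂μ) * (∫ p, ‖W.amp p‖ ∂μ) ^ (m + 1)) := by
        rw [integral_mul_const]
        exact mul_le_mul_of_nonneg_right (integral_abs_kern_le hD m) h0
    _ = _ := by rw [mul_pow, pow_succ]; ring

lemma ratio_lt_one {D r : ℝ} (hD : D ≠ 0) (hr : r < |D|) : |D|⁻¹ * r < 1 := by
  rw [inv_mul_lt_iff₀ (abs_pos.2 hD), mul_one]; exact hr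

lemma tsum_lintegral_term_ne_top {D : ℝ} (hD : D ≠ 0) (hr : ∫ p, ‖W.amp p‖ ∂μ < |D|) (x : ℝ) :
    ∑' m, ∫⁻ y, ‖W.term D m x y‖ₑ ≠ ⊤ :=
  tsum_lintegral_enorm_ne_top (fun m => W.integrable_term hD m x)
    (mul_nonneg (by positivity) (integral_nonneg fun _ => norm_nonneg _))
    (ratio_lt_one hD hr) fun m => W.integral_norm_term_le hD m x

variable [SigmaFinite μ]

lemma integral_norm_termAmp_le {D : ℝ} (hD : D ≠ 0) (m : ℕ) :
    ∫ z, ‖W.termAmp D m z‖ ∂(tupleMeasure μ m) ≤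
      ((1 + |D|) * poissonMass D * (∫ p, ‖W.derivAmp p‖ ∂μ) * (∫ p, ‖W.amp p‖ ∂μ)) *
        (|D|⁻¹ * ∫ p, ‖W.amp p‖ ∂μ) ^ m := by
  have hJ := poissonMass_nonneg D
  have hA : ∫ z, ‖W.totalAmp m z‖ ∂(tupleMeasure μ m) =
      (∫ p, ‖W.derivAmp p‖ ∂μ) * (∫ p, ‖W.amp p‖ ∂μ) ^ (m + 1) := by
    have h := integral_fintype_prod_eq_pow (ι := Fin (m + 1)) (μ := μ) (fun p => ‖W.amp p‖)
    rw [Fintype.card_fin] at h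
    rw [← h, ← integral_prod_mul]
    simp only [totalAmp, norm_mul, norm_prod]
  calc ∫ z, ‖W.termAmp D m z‖ ∂(tupleMeasure μ m)
      ≤ ∫ z, ((1 + |D|) * poissonMass D * |D|⁻¹ ^ m) * ‖W.totalAmp m z‖ ∂(tupleMeasure μ m) := by
        refine integral_mono (W.integrable_termAmp hD m).norm
          ((W.integrable_totalAmp m).norm.const_mul _) fun z => ?_
        simp only [termAmp, norm_mul]
        rw [mul_comm]
        gcongr
        refine (norm_kernHat_le hD m _).trans (mul_le_of_le_one_right (by positivity) ?_)
        exact min_le_left _ _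
    _ = _ := by
        rw [integral_const_mul, hA, mul_pow, pow_succ (∫ p, ‖W.amp p‖ ∂μ)]; ring

/-- Integrating the expansion termwise in `y` gives a function of `x` whose Fourier transform is
integrable, with a weighted bound. -/
theorem exists_density {D : ℝ} (hD : D ≠ 0) (hr : ∫ p, ‖W.amp p‖ ∂μ < |D|) :
    ∃ H : ℝ → ℂ, Integrable H ∧
      (∀ x : ℝ, ∫ y, ∑' m, W.term D m x y =
        ∫ ξ : ℝ, H ξ * Complex.exp (Complex.I * x * ξ)) ∧
      ∀ s : ℝ, 0 ≤ s → ∫⁻ ξ, ENNReal.ofReal (|ξ| ^ s) * ‖H ξ‖ₑ ≤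
        ∑' m : ℕ, 4 * (ENNReal.ofReal
            ((1 + |D|) * poissonMass D * |D|⁻¹ ^ m * ((m : ℝ) + 2) ^ (s + 1)) *
          (W.mass (fun ξ => tamedWeight s ξ * |ξ|) * W.mass (fun _ => 1) ^ (m + 1) +
            (m + 1) * (W.mass (fun ξ => |ξ|) *
              (W.mass (tamedWeight s) * W.mass (fun _ => 1) ^ m)))) := by
  choose H hHi hHw hHx using fun m =>
    exists_fourier_density (W.qmp_totalFreq m) (W.integrable_termAmp hD m)
  have hamp := tsum_lintegral_enorm_ne_top (fun m => W.integrable_termAmp hD m)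
    (mul_nonneg (by positivity) (integral_nonneg fun _ => norm_nonneg _))
    (ratio_lt_one hD hr) fun m => W.integral_norm_termAmp_le hD m
  -- The weighted bound with weight `1` transfers summability from the amplitudes to their
  -- densities.
  have hHsum : ∑' m, ∫⁻ ξ, ‖H m ξ‖ₑ ≠ ⊤ := by
    refine ne_top_of_le_ne_top (ENNReal.mul_ne_top (by norm_num : (4 : ℝ≥0∞) ≠ ⊤) hamp) ?_
    rw [← ENNReal.tsum_mul_left]
    refine ENNReal.tsum_le_tsum fun m => ?_
    simpa using hHw m (fun _ => 1) measurable_const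
  refine ⟨fun ξ => ∑' m, H m ξ, integrable_tsum hHi hHsum, fun x => ?_, fun s hs => ?_⟩
  · have hexp : Continuous fun ξ : ℝ => Complex.exp (Complex.I * x * ξ) := by fun_prop
    -- Sum and integral are exchanged on both sides, in `y` here and in `ξ` below, which reduces the
    -- identity to one `m`.
    rw [integral_tsum (fun m => (W.integrable_term hD m x).aestronglyMeasurable)
      (W.tsum_lintegral_term_ne_top hD hr x)]
    simp_rw [← tsum_mul_right]
    rw [integral_tsum (f := fun m (ξ : ℝ) => H m ξ * Complex.exp (Complex.I * x * ξ))
      (fun m => (hHi m).aestronglyMeasurable.mul hexp.aestronglyMeasurable)]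
    · refine tsum_congr fun m => ?_
      rw [hHx]
      exact W.integral_kern_mul hD m x
    · have : ∀ ξ : ℝ, ‖Complex.exp (Complex.I * x * ξ)‖ₑ = 1 := fun ξ => by
        rw [← ofReal_norm, norm_exp_I_mul_mul, ENNReal.ofReal_one]
      simp_rw [enorm_mul, this, mul_one]
      exact hHsum
  · have hw : Measurable fun ξ : ℝ => ENNReal.ofReal (|ξ| ^ s) :=
      (measurable_id.abs.pow_const s).ennreal_ofReal
    refine (lintegral_mul_enorm_tsum_le hHi hw).trans (ENNReal.tsum_le_tsum fun m => ?_)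
    refine (hHw m _ hw).trans ?_
    gcongr
    exact W.lintegral_rpow_mul_termAmp_le hD hs m

end WaveData

/-! ### The generating functions `F_1`, `F_2` and the choice of constants -/

section Series

lemma hasSum_F2 {C₀ s x : ℝ} (h : |(2 : ℝ) ^ s * C₀ * x| < 1) :
    HasSum (fun l : ℕ => ((2 : ℝ) ^ s * C₀) ^ (l + 1) * x ^ l) (F2 C₀ s x) := by
  refine Summable.hasSum ?_
  refine ((summable_geometric_of_abs_lt_one h).mul_left ((2 : ℝ) ^ s * C₀)).congr fun l => ?_
  rw [mul_pow _ x, pow_succ]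
  ring

lemma hasSum_F1 {C₀ s x : ℝ} (h : |(2 : ℝ) ^ s * C₀ * x| < 1) :
    HasSum (fun l : ℕ => ((2 : ℝ) ^ s * C₀) ^ (l + 1) * x ^ (l + 1)) (F1 C₀ s x) := by
  refine ((hasSum_F2 h).mul_left x).congr_fun fun l => ?_
  ring

/-- The factor `max 1 A` covers both coefficient sequences needed, `A ^ (l + 1)` for `F2` and `A ^
l` for `F1`. -/
lemma hasFPowerSeriesOnBall_ofScalars {c : ℕ → ℝ} {f : ℝ → ℝ} {A : ℝ} (hA : 0 < A)
    (hc : ∀ l, |c l| ≤ max 1 A * A ^ l)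
    (hf : ∀ x, |A * x| < 1 → HasSum (fun l => c l * x ^ l) (f x)) :
    HasFPowerSeriesOnBall f (FormalMultilinearSeries.ofScalars ℝ c) 0 (ENNReal.ofReal A⁻¹) where
  r_le := by
    refine FormalMultilinearSeries.le_radius_of_bound (r := A⁻¹.toNNReal) _ (max 1 A) fun l => ?_
    rw [FormalMultilinearSeries.ofScalars_norm, Real.coe_toNNReal _ (by positivity),
      Real.norm_eq_abs]
    calc |c l| * A⁻¹ ^ l ≤ (max 1 A * A ^ l) * A⁻¹ ^ l := by gcongr; exact hc l
      _ = max 1 A := by rw [mul_assoc, ← mul_pow, mul_inv_cancel₀ hA.ne', one_pow, mul_one]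
  r_pos := by positivity
  hasSum := by
    intro x hx
    rw [zero_add]
    have hx' : |x| < A⁻¹ := by
      rw [Metric.mem_eball, edist_zero_right, ← ofReal_norm, Real.norm_eq_abs] at hx
      exact (ENNReal.ofReal_lt_ofReal_iff (by positivity)).1 hx
    have h1 : |A * x| < 1 := by
      rw [abs_mul, abs_of_pos hA, mul_comm]
      simpa [hA.ne'] using mul_lt_mul_of_pos_right hx' hA
    refine (hf x h1).congr_fun fun l => ?_
    rw [FormalMultilinearSeries.ofScalars_apply_eq]
    simp

lemma hasFPowerSeriesOnBall_F2 {C₀ : ℝ} (hC : 0 < C₀) (s : ℝ) :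
    HasFPowerSeriesOnBall (F2 C₀ s)
      (FormalMultilinearSeries.ofScalars ℝ (fun l : ℕ => ((2 : ℝ) ^ s * C₀) ^ (l + 1)))
      0 (ENNReal.ofReal ((2 : ℝ) ^ s * C₀)⁻¹) := by
  have hA : 0 < (2 : ℝ) ^ s * C₀ := by positivity
  refine hasFPowerSeriesOnBall_ofScalars hA (fun l => ?_) fun x hx => hasSum_F2 hx
  rw [abs_of_nonneg (by positivity), pow_succ, mul_comm]
  gcongr
  exact le_max_right _ _

lemma hasFPowerSeriesOnBall_F1 {C₀ : ℝ} (hC : 0 < C₀) (s : ℝ) :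
    HasFPowerSeriesOnBall (F1 C₀ s)
      (FormalMultilinearSeries.ofScalars ℝ
        (fun l : ℕ => if l = 0 then (0 : ℝ) else ((2 : ℝ) ^ s * C₀) ^ l))
      0 (ENNReal.ofReal ((2 : ℝ) ^ s * C₀)⁻¹) := by
  have hA : 0 < (2 : ℝ) ^ s * C₀ := by positivity
  refine hasFPowerSeriesOnBall_ofScalars hA (fun l => ?_) fun x hx => ?_
  · split_ifs
    · rw [abs_zero]; positivity
    · rw [abs_of_nonneg (by positivity)]
      exact le_mul_of_one_le_left (by positivity) (le_max_left _ _)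
  -- The coefficient at `l = 0` vanishes, so dropping it gives the series indexed from `1`.
  · rw [← hasSum_nat_add_iff' 1]
    simpa using hasSum_F1 hx

/-- Since `m + 2 ≤ 2 ^ (m + 1)`, the factor `(m + 2) ^ s` is at most `(2 ^ s) ^ (m + 1)` and `(m +
1)(m + 2)` is at most `4 ^ (m + 1)`. The `16` in the lower bound on `C₀` beats the latter, and `1 ≤
C₀` supplies the missing power of `C₀`. -/
lemma coeff_le {D C₀ s : ℝ} (hs : 0 ≤ s) (h1 : 1 ≤ C₀) (hD : 16 * |D|⁻¹ ≤ C₀) (m : ℕ) :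
    ((m : ℝ) + 1) * (|D|⁻¹ ^ m * ((m : ℝ) + 2) ^ (s + 1)) ≤ 4 * ((2 : ℝ) ^ s * C₀) ^ (m + 1) := by
  have hm : (m : ℝ) + 2 ≤ 2 ^ (m + 1) := by
    have : m + 2 ≤ 2 ^ (m + 1) := Nat.lt_two_pow_self (n := m + 1)
    exact_mod_cast this
  have hD' : |D|⁻¹ ≤ C₀ / 16 := by linarith
  have e1 : ((m : ℝ) + 2) ^ s ≤ ((2 : ℝ) ^ s) ^ (m + 1) := by
    rw [← Real.rpow_mul_natCast (by norm_num), mul_comm s, Real.rpow_mul (by norm_num),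
      Real.rpow_natCast]
    exact Real.rpow_le_rpow (by positivity) hm hs
  calc ((m : ℝ) + 1) * (|D|⁻¹ ^ m * ((m : ℝ) + 2) ^ (s + 1))
      = |D|⁻¹ ^ m * ((m : ℝ) + 2) ^ s * (((m : ℝ) + 1) * ((m : ℝ) + 2)) := by
        rw [Real.rpow_add_one (by positivity)]; ring
    _ ≤ (C₀ / 16) ^ m * ((2 : ℝ) ^ s) ^ (m + 1) * (2 ^ (m + 1) * 2 ^ (m + 1)) := by
        gcongr
        linarith
    _ = 4 * ((2 : ℝ) ^ s) ^ (m + 1) * (C₀ / 4) ^ m := by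
        have : (C₀ / 4) ^ m = (C₀ / 16) ^ m * 4 ^ m := by rw [← mul_pow]; congr 1; ring
        rw [this, show (4 : ℝ) ^ m = 2 ^ m * 2 ^ m by rw [← mul_pow]; norm_num]
        ring
    _ ≤ 4 * ((2 : ℝ) ^ s) ^ (m + 1) * C₀ ^ (m + 1) := by
        gcongr
        calc (C₀ / 4) ^ m ≤ C₀ ^ m := by gcongr; linarith
          _ ≤ C₀ ^ (m + 1) := pow_le_pow_right₀ h1 (Nat.le_succ m)
    _ = _ := by rw [mul_pow]; ring

/-- Summation of the bounds of the terms of the expansion. -/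
lemma tsum_bound_le {D C₀ s r c : ℝ} (hs : 0 ≤ s) (h1 : 1 ≤ C₀) (hD : 16 * |D|⁻¹ ≤ C₀)
    (hr : 0 ≤ r) (hr1 : (2 : ℝ) ^ s * C₀ * r < 1) (hc : 0 ≤ c) {R U V M : ℝ≥0∞}
    (hR : R ≤ ENNReal.ofReal r) :
    ∑' m : ℕ, 4 * (ENNReal.ofReal (c * |D|⁻¹ ^ m * ((m : ℝ) + 2) ^ (s + 1)) *
        (U * R ^ (m + 1) + (m + 1) * (M * (V * R ^ m)))) ≤
      ENNReal.ofReal (16 * c) * (ENNReal.ofReal (F1 C₀ s r) * U +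
        M * ENNReal.ofReal (F2 C₀ s r) * V) := by
  have hA : 0 ≤ (2 : ℝ) ^ s * C₀ := by positivity
  have hr1' : |(2 : ℝ) ^ s * C₀ * r| < 1 := by rwa [abs_of_nonneg (by positivity)]
  have hF1 : ENNReal.ofReal (F1 C₀ s r) =
      ∑' l : ℕ, ENNReal.ofReal (((2 : ℝ) ^ s * C₀) ^ (l + 1) * r ^ (l + 1)) := by
    rw [← (hasSum_F1 hr1').tsum_eq]
    exact ENNReal.ofReal_tsum_of_nonneg (fun l => by positivity) (hasSum_F1 hr1').summable
  have hF2 : ENNReal.ofReal (F2 C₀ s r) =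
      ∑' l : ℕ, ENNReal.ofReal (((2 : ℝ) ^ s * C₀) ^ (l + 1) * r ^ l) := by
    rw [← (hasSum_F2 hr1').tsum_eq]
    exact ENNReal.ofReal_tsum_of_nonneg (fun l => by positivity) (hasSum_F2 hr1').summable
  rw [hF1, hF2, ← ENNReal.tsum_mul_right, ← ENNReal.tsum_mul_left, ← ENNReal.tsum_mul_right,
    ← ENNReal.tsum_add, ← ENNReal.tsum_mul_left]
  refine ENNReal.tsum_le_tsum fun m => ?_
  have hco := coeff_le hs h1 hD m
  have hm1 : ((m : ℝ≥0∞) + 1) = ENNReal.ofReal ((m : ℝ) + 1) := by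
    rw [ENNReal.ofReal_add (by positivity) (by norm_num), ENNReal.ofReal_natCast,
      ENNReal.ofReal_one]
  have h4 : (4 : ℝ≥0∞) = ENNReal.ofReal 4 := by simp
  have hRp : ∀ l : ℕ, R ^ l ≤ ENNReal.ofReal (r ^ l) := fun l => by
    rw [ENNReal.ofReal_pow hr]; gcongr
  have hb : (m + 1) * (c * |D|⁻¹ ^ m * ((m : ℝ) + 2) ^ (s + 1)) ≤
      4 * c * ((2 : ℝ) ^ s * C₀) ^ (m + 1) := by
    have := mul_le_mul_of_nonneg_left hco hc
    linarith
  have hX : 0 ≤ c * |D|⁻¹ ^ m * ((m : ℝ) + 2) ^ (s + 1) := by positivity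
  have hY : 0 ≤ ((2 : ℝ) ^ s * C₀) ^ (m + 1) := by positivity
  generalize c * |D|⁻¹ ^ m * ((m : ℝ) + 2) ^ (s + 1) = x at hb hX ⊢
  generalize ((2 : ℝ) ^ s * C₀) ^ (m + 1) = y at hb hY ⊢
  -- The `U` term has no factor `m + 1`, so the same bound holds for it a fortiori. Below, `16 = 4 *
  -- 4` combines the constant of the splitting into four parts with that of `coeff_le`.
  have hb' : x ≤ 4 * c * y :=
    (le_mul_of_one_le_left hX (by linarith [(Nat.cast_nonneg m : (0 : ℝ) ≤ m)])).trans hb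
  have e1 : ENNReal.ofReal 4 * ENNReal.ofReal x ≤ ENNReal.ofReal (16 * c) * ENNReal.ofReal y := by
    rw [← ENNReal.ofReal_mul (by norm_num), ← ENNReal.ofReal_mul (by positivity)]
    exact ENNReal.ofReal_le_ofReal (by linarith)
  have e2 : ENNReal.ofReal 4 * (ENNReal.ofReal x * ENNReal.ofReal ((m : ℝ) + 1)) ≤
      ENNReal.ofReal (16 * c) * ENNReal.ofReal y := by
    rw [← ENNReal.ofReal_mul hX, ← ENNReal.ofReal_mul (by norm_num),
      ← ENNReal.ofReal_mul (by positivity)]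
    exact ENNReal.ofReal_le_ofReal (by linarith)
  rw [h4, hm1, ENNReal.ofReal_mul hY, ENNReal.ofReal_mul hY]
  calc _ = (ENNReal.ofReal 4 * ENNReal.ofReal x) * (U * R ^ (m + 1)) +
        (ENNReal.ofReal 4 * (ENNReal.ofReal x * ENNReal.ofReal ((m : ℝ) + 1))) *
          (M * (V * R ^ m)) := by ring
    _ ≤ (ENNReal.ofReal (16 * c) * ENNReal.ofReal y) * (U * ENNReal.ofReal (r ^ (m + 1))) +
        (ENNReal.ofReal (16 * c) * ENNReal.ofReal y) * (M * (V * ENNReal.ofReal (r ^ m))) := by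
        gcongr
        · exact hRp _
        · exact hRp _
    _ = _ := by ring

end Series

/-! ### Comparison of the tamed weight with `λ̃` -/

section Weight

/-- Linear growth gives the bound on `[0, δ]`, monotonicity keeps `lam` above `α * δ / 2` beyond
`δ`, and evenness handles negative `ξ`. -/
lemma IsTildeLambda.exists_min_le {n : ℕ} {ρ : Fin (n + 1) → ℝ} {d : Fin n → ℝ} {lam : ℝ → ℝ}
    (h : IsTildeLambda ρ d lam) : ∃ L : ℝ, 0 ≤ L ∧ ∀ ξ, min 1 |ξ| ≤ L * lam ξ := by
  obtain ⟨α, hα, hlow⟩ := h.lower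
  obtain ⟨ε, hε, hball⟩ := Metric.eventually_nhds_iff.1 hlow
  set δ := min 1 (ε / 2) with hδ
  have hδ0 : 0 < δ := lt_min one_pos (by positivity)
  have hδε : δ < ε := (min_le_right _ _).trans_lt (by linarith)
  have hδ1 : δ ≤ 1 := min_le_left _ _
  have hlow' : ∀ t, 0 ≤ t → t ≤ δ → α / 2 * t ≤ lam t := fun t ht htδ => by
    have := hball (y := t) (by rw [dist_zero_right, Real.norm_of_nonneg ht]; linarith)
    rwa [abs_of_nonneg ht] at this
  have habs : ∀ ξ, lam ξ = lam |ξ| := fun ξ => by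
    rcases abs_choice ξ with e | e <;> rw [e]
    exact (h.even ξ).symm
  have hkey : ∀ t, 0 ≤ t → α * δ / 2 * min 1 t ≤ lam t := fun t ht => by
    rcases le_total t δ with h1 | h1
    · refine le_trans ?_ (hlow' t ht h1)
      have : δ * min 1 t ≤ 1 * t :=
        mul_le_mul hδ1 (min_le_right _ _) (by positivity) zero_le_one
      nlinarith
    · refine le_trans ?_ ((hlow' δ hδ0.le le_rfl).trans (h.mono hδ0.le ht h1))
      have := mul_le_mul_of_nonneg_left (min_le_left 1 t) (by positivity : 0 ≤ α * δ / 2)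
      linarith
  refine ⟨(α * δ / 2)⁻¹, by positivity, fun ξ => ?_⟩
  rw [habs, ← div_eq_inv_mul, le_div_iff₀ (by positivity), mul_comm]
  exact hkey _ (abs_nonneg ξ)

lemma weightedNorm_le_of_le {w w' : ℝ → ℝ} {L : ℝ} (hL : 0 ≤ L) (h : ∀ ξ, w ξ ≤ L * w' ξ)
    (F : ℝ → ℂ) : weightedNorm w F ≤ ENNReal.ofReal L * weightedNorm w' F := by
  rw [weightedNorm, weightedNorm, ← lintegral_const_mul' _ _ ENNReal.ofReal_ne_top]
  refine lintegral_mono fun ξ => ?_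
  rw [← mul_assoc, ← ENNReal.ofReal_mul hL]
  gcongr
  exact h ξ

lemma tamedWeight_le {lam : ℝ → ℝ} {L : ℝ} (hL : ∀ ξ, min 1 |ξ| ≤ L * lam ξ) (s ξ : ℝ) :
    tamedWeight s ξ ≤ L * (lam ξ * |ξ| ^ s) := by
  rw [tamedWeight, mul_comm, ← mul_assoc]
  gcongr
  exact hL ξ

lemma tamedWeight_mul_abs {s : ℝ} (hs : 0 ≤ s) (ξ : ℝ) :
    tamedWeight s ξ * |ξ| = tamedWeight (s + 1) ξ := by
  rw [tamedWeight, tamedWeight, Real.rpow_add_one' (abs_nonneg _) (by linarith)]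
  ring

end Weight

/-! ### The bracket as a superposition of waves -/

/-- Two copies of the line with Lebesgue measure. -/
def twoLines : Measure (ℝ × Bool) :=
  (volume : Measure ℝ).prod (Measure.dirac false + Measure.dirac true)

instance : SigmaFinite twoLines := by unfold twoLines; infer_instance

lemma twoLines_eq : twoLines =
    (volume : Measure ℝ).map (fun x => (x, false)) + (volume : Measure ℝ).map (fun x => (x, true)) := by
  rw [twoLines, Measure.prod_add, Measure.prod_dirac, Measure.prod_dirac]

lemma measurableEmbedding_mk (b : Bool) : MeasurableEmbedding fun x : ℝ => (x, b) :=
  measurableEmbedding_prod_mk_right b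

lemma integrable_twoLines {f : ℝ × Bool → ℂ} : Integrable f twoLines ↔
    (Integrable fun x => f (x, false)) ∧ Integrable fun x => f (x, true) := by
  rw [twoLines_eq, integrable_add_measure, (measurableEmbedding_mk _).integrable_map_iff,
    (measurableEmbedding_mk _).integrable_map_iff]
  rfl

lemma integral_twoLines {f : ℝ × Bool → ℂ} (h : Integrable f twoLines) :
    ∫ p, f p ∂twoLines = (∫ x, f (x, false)) + ∫ x, f (x, true) := by
  rw [twoLines_eq, integrable_add_measure] at h
  rw [twoLines_eq, integral_add_measure h.1 h.2, (measurableEmbedding_mk _).integral_map,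
    (measurableEmbedding_mk _).integral_map]

lemma lintegral_twoLines (f : ℝ × Bool → ℝ≥0∞) :
    ∫⁻ p, f p ∂twoLines = (∫⁻ x, f (x, false)) + ∫⁻ x, f (x, true) := by
  rw [twoLines_eq, lintegral_add_measure, (measurableEmbedding_mk _).lintegral_map,
    (measurableEmbedding_mk _).lintegral_map]

lemma integrable_of_wienerNorm_zero {F : ℝ → ℂ} (hm : AEStronglyMeasurable F)
    (h : wienerNorm 0 F < ⊤) : Integrable F :=
  ⟨hm, by simpa [wienerNorm, weightedNorm, HasFiniteIntegral] using h⟩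

lemma integrable_of_wienerNorm_one {F : ℝ → ℂ} (hm : AEStronglyMeasurable F)
    (h : wienerNorm 1 F < ⊤) : Integrable fun ξ : ℝ => (ξ : ℂ) * F ξ := by
  refine ⟨(Complex.continuous_ofReal.aestronglyMeasurable).mul hm, ?_⟩
  refine lt_of_eq_of_lt (lintegral_congr fun ξ => ?_) h
  simp only [Real.rpow_one]
  rw [enorm_mul, ← ofReal_norm (ξ : ℂ), Complex.norm_real, Real.norm_eq_abs]

/-- The waves whose superposition is `[f, g]_y(x)`, for `f` and `g` with Fourier transforms `F`
and `G`. -/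
def bracketWave (F G : ℝ → ℂ) (hF : Integrable F) (hG : Integrable G)
    (hF1 : Integrable fun ξ : ℝ => (ξ : ℂ) * F ξ) (hG1 : Integrable fun ξ : ℝ => (ξ : ℂ) * G ξ) :
    WaveData twoLines where
  -- The `false` copy carries `f(x)`, which does not depend on `y`, hence shift `0`; the `true` copy
  -- carries `-g(x - y)`, whose shift equals its frequency.
  freq p := p.1
  shift p := cond p.2 p.1 0
  amp p := (2 * Real.pi : ℂ)⁻¹ * cond p.2 (-G p.1) (F p.1)
  qmp_freq := Measure.quasiMeasurePreserving_fst
  measurable_shift := by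
    refine measurable_from_prod_countable_left fun b => ?_
    cases b
    · exact measurable_const
    · exact measurable_id
  abs_shift_le p := by
    rcases p with ⟨x, _ | _⟩
    · simp
    · exact le_rfl
  integrable_amp := integrable_twoLines.2 ⟨hF.const_mul _, hG.neg.const_mul _⟩
  integrable_freq_mul_amp := by
    refine integrable_twoLines.2 ⟨?_, ?_⟩
    · refine (hF1.const_mul (2 * Real.pi : ℂ)⁻¹).congr (Eventually.of_forall fun ξ => ?_)
      simp only [cond_false]; ring
    · refine (hG1.const_mul (-(2 * Real.pi : ℂ)⁻¹)).congr (Eventually.of_forall fun ξ => ?_)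
      simp only [cond_true]; ring

lemma enorm_two_pi_inv_le : ‖(2 * Real.pi : ℂ)⁻¹‖ₑ ≤ 1 := by
  rw [← ofReal_norm, ENNReal.ofReal_le_one, norm_inv, norm_mul, Complex.norm_real,
    Real.norm_of_nonneg Real.pi_pos.le]
  refine inv_le_one_of_one_le₀ ?_
  simp only [Complex.norm_ofNat]
  linarith [Real.pi_gt_three]

section BracketWave

variable {F G : ℝ → ℂ} (hF : Integrable F) (hG : Integrable G)
  (hF1 : Integrable fun ξ : ℝ => (ξ : ℂ) * F ξ) (hG1 : Integrable fun ξ : ℝ => (ξ : ℂ) * G ξ)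

lemma bracketWave_wave (x y : ℝ) :
    (bracketWave F G hF hG hF1 hG1).wave x y = invFourierInt F x - invFourierInt G (x - y) := by
  set W := bracketWave F G hF hG hF1 hG1 with hW
  have hint : Integrable (fun p => W.amp p * W.phase x y p) twoLines :=
    W.integrable_mul_phase W.integrable_amp x y
  rw [WaveData.wave, integral_twoLines hint, invFourierInt, invFourierInt,
    ← integral_const_mul, ← integral_const_mul, sub_eq_add_neg, ← integral_neg]
  congr 1
  · refine integral_congr_ae (Eventually.of_forall fun ξ => ?_)
    simp [hW, bracketWave, WaveData.phase, mul_assoc]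
  · refine integral_congr_ae (Eventually.of_forall fun ξ => ?_)
    simp only [hW, bracketWave, WaveData.phase, cond_true, ← Complex.exp_add]
    have : Complex.I * x * ξ + -(Complex.I * y * ξ) = Complex.I * ((x - y : ℝ) : ℂ) * ξ := by
      push_cast; ring
    rw [this]
    ring

lemma bracketWave_mass_le (w : ℝ → ℝ) :
    (bracketWave F G hF hG hF1 hG1).mass w ≤ weightedNorm w F + weightedNorm w G := by
  rw [WaveData.mass, lintegral_twoLines, weightedNorm, weightedNorm]
  refine add_le_add (lintegral_mono fun ξ => ?_) (lintegral_mono fun ξ => ?_)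
  · simp only [bracketWave, cond_false, enorm_mul]
    gcongr
    exact mul_le_of_le_one_left' enorm_two_pi_inv_le
  · simp only [bracketWave, cond_true, enorm_mul, enorm_neg]
    gcongr
    exact mul_le_of_le_one_left' enorm_two_pi_inv_le

lemma bracketWave_integral_amp_le (hF0 : wienerNorm 0 F < ⊤) (hG0 : wienerNorm 0 G < ⊤) :
    ∫ p, ‖(bracketWave F G hF hG hF1 hG1).amp p‖ ∂twoLines ≤
      (wienerNorm 0 F + wienerNorm 0 G).toReal := by
  rw [integral_norm_eq_lintegral_enorm
    (bracketWave F G hF hG hF1 hG1).integrable_amp.aestronglyMeasurable]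
  refine ENNReal.toReal_mono (ENNReal.add_ne_top.2 ⟨hF0.ne, hG0.ne⟩) ?_
  simpa [WaveData.mass, wienerNorm] using bracketWave_mass_le hF hG hF1 hG1 fun ξ => |ξ| ^ (0 : ℝ)

end BracketWave

/-! ### The nonlinear term and the final estimate -/

lemma WaveData.hasSum_term {X : Type*} [MeasurableSpace X] {μ : Measure X} (W : WaveData μ)
    {D b x y : ℝ} (hD : D ≠ 0) (hb : |b| < |D|) (hW : W.wave x y = b) :
    HasSum (fun m => W.term D m x y)
      (W.waveDeriv x y * ((y / (y ^ 2 + (D + b) ^ 2) - y / (y ^ 2 + D ^ 2) : ℝ) : ℂ)) := by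
  have h := (Complex.hasSum_ofReal.2 (hasSum_kern hD hb y)).mul_left (W.waveDeriv x y)
  refine h.congr_fun fun m => ?_
  rw [WaveData.term, hW]
  push_cast
  ring

/-- Partial fractions; `|b| < |D|` keeps `D + b` away from `0`, so the denominators are nonzero even
at `y = 0`. -/
lemma div_sub_div_eq {D b : ℝ} (hD : D ≠ 0) (hb : |b| < |D|) (y c : ℝ) :
    (y * c * (D ^ 2 - (D + b) ^ 2)) / ((y ^ 2 + D ^ 2) * (y ^ 2 + (D + b) ^ 2)) =
      c * (y / (y ^ 2 + (D + b) ^ 2) - y / (y ^ 2 + D ^ 2)) := by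
  have hDb : D + b ≠ 0 := by
    intro h
    rw [eq_neg_of_add_eq_zero_left h, abs_neg] at hb
    exact lt_irrefl _ hb
  have h1 : y ^ 2 + D ^ 2 ≠ 0 := by positivity
  have h2 : y ^ 2 + (D + b) ^ 2 ≠ 0 := by positivity
  field_simp
  ring

lemma ofReal_deriv_eq {f : ℝ → ℝ} {x : ℝ} {c : ℂ} (h : HasDerivAt (fun t => (f t : ℂ)) c x) :
    ((deriv f x : ℝ) : ℂ) = c := by
  have hre : HasDerivAt f c.re x := Complex.reCLM.hasFDerivAt.comp_hasDerivAt x h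
  rw [hre.deriv]
  exact hre.ofReal_comp.unique h

/-- The constant `C₀` of the geometric series, depending only on the depths `d`. -/
def baseConst {n : ℕ} (d : Fin n → ℝ) : ℝ :=
  -- Diagonal terms contribute `0`, by the convention `0⁻¹ = 0`.
  1 + ∑ k, ∑ j, 16 * |d k - d j|⁻¹

lemma single_le_sum_sum {n : ℕ} {f : Fin n → Fin n → ℝ} (hf : ∀ k j, 0 ≤ f k j) (k j : Fin n) :
    f k j ≤ ∑ k, ∑ j, f k j :=
  (Finset.single_le_sum (f := fun j => f k j) (fun j _ => hf k j) (Finset.mem_univ j)).trans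
    (Finset.single_le_sum (f := fun k => ∑ j, f k j)
      (fun k _ => Finset.sum_nonneg fun j _ => hf k j) (Finset.mem_univ k))

lemma le_baseConst {n : ℕ} (d : Fin n → ℝ) (k j : Fin n) :
    16 * |d k - d j|⁻¹ ≤ baseConst d := by
  have := single_le_sum_sum (f := fun k j => 16 * |d k - d j|⁻¹) (fun k j => by positivity) k j
  unfold baseConst
  linarith

lemma one_le_baseConst {n : ℕ} (d : Fin n → ℝ) : 1 ≤ baseConst d := by
  unfold baseConst
  have : 0 ≤ ∑ k, ∑ j, 16 * |d k - d j|⁻¹ :=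
    Finset.sum_nonneg fun k _ => Finset.sum_nonneg fun j _ => by positivity
  linarith

/-- The nonlinear term is the inverse Fourier transform of an integrable function with a weighted
bound given by the masses of the amplitudes. -/
lemma nonlinear_estimate {n : ℕ} {d : Fin n → ℝ} {C₀ s : ℝ} (hs : 0 ≤ s) (hC1 : 1 ≤ C₀)
    {k j : Fin n} (hD : d k - d j ≠ 0) (hCD : 16 * |d k - d j|⁻¹ ≤ C₀)
    {g : Fin n → ℝ → ℝ} {G : Fin n → ℝ → ℂ}
    (hg : ∀ i : Fin n, i = k ∨ i = j → Continuous (g i) ∧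
      IsFourierTransform (fun x => ((g i x : ℝ) : ℂ)) (G i) ∧
      wienerNorm 0 (G i) < ⊤ ∧ wienerNorm 1 (G i) < ⊤)
    (hsmall : (2 : ℝ) ^ s * C₀ * (wienerNorm 0 (G k) + wienerNorm 0 (G j)).toReal < 1) :
    (∀ x : ℝ, Integrable (nonlinearIntegrand d g k j x)) ∧
    ∃ H : ℝ → ℂ, Integrable H ∧
      (∀ x : ℝ, ((∫ y, nonlinearIntegrand d g k j x y : ℝ) : ℂ) =
        ∫ ξ : ℝ, H ξ * Complex.exp (Complex.I * x * ξ)) ∧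
      ∫⁻ ξ, ENNReal.ofReal (|ξ| ^ s) * ‖H ξ‖ₑ ≤
        ENNReal.ofReal (16 * ((1 + |d k - d j|) * poissonMass (d k - d j))) *
          (ENNReal.ofReal (F1 C₀ s (wienerNorm 0 (G k) + wienerNorm 0 (G j)).toReal) *
            (weightedNorm (tamedWeight (s + 1)) (G k) + weightedNorm (tamedWeight (s + 1)) (G j)) +
          (wienerNorm 1 (G k) + wienerNorm 1 (G j)) *
            ENNReal.ofReal (F2 C₀ s (wienerNorm 0 (G k) + wienerNorm 0 (G j)).toReal) *
            (weightedNorm (tamedWeight s) (G k) + weightedNorm (tamedWeight s) (G j))) := by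
  obtain ⟨hck, hFk, hk0, hk1⟩ := hg k (Or.inl rfl)
  obtain ⟨hcj, hFj, hj0, hj1⟩ := hg j (Or.inr rfl)
  have ik := integrable_of_wienerNorm_zero hFk.aestronglyMeasurable hk0
  have ij := integrable_of_wienerNorm_zero hFj.aestronglyMeasurable hj0
  have ik1 := integrable_of_wienerNorm_one hFk.aestronglyMeasurable hk1
  have ij1 := integrable_of_wienerNorm_one hFj.aestronglyMeasurable hj1
  -- Continuity makes the inversion formula hold at every point, so the bracket and its derivative
  -- can be computed pointwise.
  have ek := hFk.eq_invFourierInt (Complex.continuous_ofReal.comp hck) ik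
  have ej := hFj.eq_invFourierInt (Complex.continuous_ofReal.comp hcj) ij
  set W := bracketWave (G k) (G j) ik ij ik1 ij1 with hW
  set D := d k - d j with hDdef
  set r := (wienerNorm 0 (G k) + wienerNorm 0 (G j)).toReal with hr
  have hr0 : 0 ≤ r := ENNReal.toReal_nonneg
  have hamp : ∫ p, ‖W.amp p‖ ∂twoLines ≤ r := bracketWave_integral_amp_le ik ij ik1 ij1 hk0 hj0
  have hDpos := abs_pos.2 hD
  -- As `C₀ ≥ |D|⁻¹` and `2 ^ s ≥ 1`, smallness gives `|D|⁻¹ * r < 1`, the ratio of the geometric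
  -- series.
  have hrD : r < |D| := by
    have h2s : (1 : ℝ) ≤ 2 ^ s := Real.one_le_rpow (by norm_num) hs
    have h1 : C₀ * r ≤ (2 : ℝ) ^ s * C₀ * r := by
      rw [mul_assoc]; exact le_mul_of_one_le_left (by positivity) h2s
    have h2 : |D|⁻¹ * r ≤ C₀ * r :=
      mul_le_mul_of_nonneg_right (by linarith [inv_pos.2 hDpos]) hr0
    have h3 : |D|⁻¹ * r < 1 := by linarith
    rwa [inv_mul_lt_iff₀ hDpos, mul_one] at h3
  have hwave : ∀ x y, W.wave x y = (bracket (g k) (g j) y x : ℝ) := fun x y => by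
    rw [hW, bracketWave_wave, ← ek, ← ej, bracket]
    push_cast
    rfl
  have hb : ∀ x y, |bracket (g k) (g j) y x| < |D| := fun x y => by
    have := W.norm_wave_le x y
    rw [hwave, Complex.norm_real, Real.norm_eq_abs] at this
    linarith
  have hderiv : ∀ x y, ((deriv (fun x' => bracket (g k) (g j) y x') x : ℝ) : ℂ) =
      W.waveDeriv x y := fun x y => by
    refine ofReal_deriv_eq ?_
    simpa only [hwave] using W.hasDerivAt_wave x y
  have hterm : ∀ x y, ((nonlinearIntegrand d g k j x y : ℝ) : ℂ) = ∑' m, W.term D m x y :=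
    fun x y => by
      rw [(W.hasSum_term hD (hb x y) (hwave x y)).tsum_eq, ← hderiv, nonlinearIntegrand, ← hDdef,
        div_sub_div_eq hD (hb x y)]
      push_cast
      rfl
  obtain ⟨H, hHi, hHx, hHs⟩ := W.exists_density hD (hamp.trans_lt hrD)
  refine ⟨fun x => ?_, H, hHi, fun x => ?_, ?_⟩
  · have h := integrable_tsum (fun m => W.integrable_term hD m x)
      (W.tsum_lintegral_term_ne_top hD (hamp.trans_lt hrD) x)
    simp_rw [← hterm] at h
    simpa using h.re
  · rw [← hHx, ← integral_complex_ofReal]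
    exact integral_congr_ae (Eventually.of_forall fun y => hterm x y)
  · have hR : W.mass (fun _ => 1) ≤ ENNReal.ofReal r := by
      rw [hr, ENNReal.ofReal_toReal (ENNReal.add_ne_top.2 ⟨hk0.ne, hj0.ne⟩)]
      simpa [wienerNorm] using bracketWave_mass_le ik ij ik1 ij1 fun ξ => |ξ| ^ (0 : ℝ)
    have hM : W.mass (fun ξ => |ξ|) ≤ wienerNorm 1 (G k) + wienerNorm 1 (G j) := by
      simpa [wienerNorm] using bracketWave_mass_le ik ij ik1 ij1 fun ξ => |ξ| ^ (1 : ℝ)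
    have hU : W.mass (fun ξ => tamedWeight s ξ * |ξ|) ≤
        weightedNorm (tamedWeight (s + 1)) (G k) + weightedNorm (tamedWeight (s + 1)) (G j) := by
      simp_rw [tamedWeight_mul_abs hs]
      exact bracketWave_mass_le ik ij ik1 ij1 _
    have hV := bracketWave_mass_le ik ij ik1 ij1 (tamedWeight s)
    have hc : 0 ≤ (1 + |D|) * poissonMass D := mul_nonneg (by positivity) (poissonMass_nonneg D)
    refine (hHs s hs).trans ((tsum_bound_le hs hC1 hCD hr0 hsmall hc hR).trans ?_)
    gcongr

end Muskat

end

lemma Muskat.weightedNorm_const_mul (w : ℝ → ℝ) (c : ℝ) (F : ℝ → ℂ) :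
    ∫⁻ ξ, ENNReal.ofReal (w ξ) * ‖(c : ℂ) * F ξ‖ₑ =
      ENNReal.ofReal |c| * ∫⁻ ξ, ENNReal.ofReal (w ξ) * ‖F ξ‖ₑ := by
  rw [← lintegral_const_mul' _ _ ENNReal.ofReal_ne_top]
  refine lintegral_congr fun ξ => ?_
  rw [enorm_mul, ← ofReal_norm (c : ℂ), Complex.norm_real, Real.norm_eq_abs, mul_left_comm]

theorem mainTheorem5 {n : ℕ} (d : Fin n → ℝ) (hd : StrictMono d) :
    ∃ C₀ : ℝ, 0 < C₀ ∧
      ∀ s : ℝ, 0 ≤ s →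
        HasFPowerSeriesOnBall (Muskat.F2 C₀ s)
          (FormalMultilinearSeries.ofScalars ℝ (fun l : ℕ => ((2 : ℝ) ^ s * C₀) ^ (l + 1)))
          0 (ENNReal.ofReal ((2 : ℝ) ^ s * C₀)⁻¹) ∧
        HasFPowerSeriesOnBall (Muskat.F1 C₀ s)
          (FormalMultilinearSeries.ofScalars ℝ
            (fun l : ℕ => if l = 0 then (0 : ℝ) else ((2 : ℝ) ^ s * C₀) ^ l))
          0 (ENNReal.ofReal ((2 : ℝ) ^ s * C₀)⁻¹) ∧
        ∀ (ρ : Fin (n + 1) → ℝ), StrictAnti ρ →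
        ∀ lam : ℝ → ℝ, Muskat.IsTildeLambda ρ d lam →
        ∃ C : ℝ, 0 < C ∧
          ∀ (k j : Fin n), k ≠ j →
          ∀ (g : Fin n → ℝ → ℝ) (G : Fin n → ℝ → ℂ),
            (∀ i : Fin n, i = k ∨ i = j →
              Continuous (g i) ∧
              Muskat.IsFourierTransform (fun x => ((g i x : ℝ) : ℂ)) (G i) ∧
              Muskat.wienerNorm 0 (G i) < ⊤ ∧
              Muskat.wienerNorm 1 (G i) < ⊤ ∧
              Muskat.wienerNorm (s + 1) (G i) < ⊤) →
            (2 : ℝ) ^ s * C₀ *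
              (Muskat.wienerNorm 0 (G k) + Muskat.wienerNorm 0 (G j)).toReal < 1 →
            (∀ x : ℝ, MeasureTheory.Integrable (Muskat.nonlinearIntegrand d g k j x)) ∧
            ∃ H : ℝ → ℂ,
              Muskat.IsFourierTransform
                (fun x => ((Muskat.nonlinearTerm ρ d g k j x : ℝ) : ℂ)) H ∧
              ∫⁻ ξ : ℝ, ENNReal.ofReal (|ξ| ^ s) * ‖H ξ‖ₑ ≤
                ENNReal.ofReal C *
                  (ENNReal.ofReal (Muskat.F1 C₀ s
                      (Muskat.wienerNorm 0 (G k) + Muskat.wienerNorm 0 (G j)).toReal) *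
                    (Muskat.weightedNorm (fun ξ => lam ξ * |ξ| ^ (s + 1)) (G k) +
                      Muskat.weightedNorm (fun ξ => lam ξ * |ξ| ^ (s + 1)) (G j)) +
                  (Muskat.wienerNorm 1 (G k) + Muskat.wienerNorm 1 (G j)) *
                    ENNReal.ofReal (Muskat.F2 C₀ s
                      (Muskat.wienerNorm 0 (G k) + Muskat.wienerNorm 0 (G j)).toReal) *
                    (Muskat.weightedNorm (fun ξ => lam ξ * |ξ| ^ s) (G k) +
                      Muskat.weightedNorm (fun ξ => lam ξ * |ξ| ^ s) (G j))) := by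
  have hC1 := Muskat.one_le_baseConst d
  refine ⟨Muskat.baseConst d, by linarith, fun s hs =>
    ⟨Muskat.hasFPowerSeriesOnBall_F2 (by linarith) s,
      Muskat.hasFPowerSeriesOnBall_F1 (by linarith) s, fun ρ _ lam hlam => ?_⟩⟩
  obtain ⟨L, hL0, hL⟩ := hlam.exists_min_le
  -- The constant for one pair; summing over all pairs makes `C` uniform in `k, j`, and adding `1`
  -- makes it positive even if the sum is `0`.
  set B : Fin n → Fin n → ℝ := fun k j => |Muskat.densityJump ρ j| *
    (16 * ((1 + |d k - d j|) * Muskat.poissonMass (d k - d j))) * L with hB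
  have hB0 : ∀ k j, 0 ≤ B k j := fun k j => by
    have := Muskat.poissonMass_nonneg (d k - d j)
    positivity
  have hsum0 : 0 ≤ ∑ k, ∑ j, B k j :=
    Finset.sum_nonneg fun k _ => Finset.sum_nonneg fun j _ => hB0 k j
  refine ⟨1 + ∑ k, ∑ j, B k j, by linarith, fun k j hkj g G hg hsmall => ?_⟩
  have hD : d k - d j ≠ 0 := sub_ne_zero.2 fun h => hkj (hd.injective h)
  obtain ⟨hint, H, hHi, hHx, hHs⟩ := Muskat.nonlinear_estimate hs hC1 hD
    (Muskat.le_baseConst d k j)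
    (fun i hi => ⟨(hg i hi).1, (hg i hi).2.1, (hg i hi).2.2.1, (hg i hi).2.2.2.1⟩) hsmall
  -- The prefactor `1 / (2π)` of the nonlinear term is exactly the one in `invFourierInt`, so only
  -- the density jump remains in the transform.
  refine ⟨hint, fun ξ => (Muskat.densityJump ρ j : ℂ) * H ξ, ?_, ?_⟩
  · have hf : (fun x => ((Muskat.nonlinearTerm ρ d g k j x : ℝ) : ℂ)) =
        Muskat.invFourierInt fun ξ => (Muskat.densityJump ρ j : ℂ) * H ξ := by
      funext x
      simp only [Muskat.nonlinearTerm, Muskat.invFourierInt, mul_assoc, integral_const_mul]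
      simp only [← mul_assoc]
      rw [← hHx]
      push_cast
      ring
    rw [hf]
    exact Muskat.isFourierTransform_invFourierInt (hHi.const_mul _)
  · rw [Muskat.weightedNorm_const_mul fun ξ => |ξ| ^ s]
    have hU : ∀ i, Muskat.weightedNorm (Muskat.tamedWeight (s + 1)) (G i) ≤
        ENNReal.ofReal L * Muskat.weightedNorm (fun ξ => lam ξ * |ξ| ^ (s + 1)) (G i) := fun i =>
      Muskat.weightedNorm_le_of_le hL0 (Muskat.tamedWeight_le hL (s + 1)) (G i)
    have hV : ∀ i, Muskat.weightedNorm (Muskat.tamedWeight s) (G i) ≤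
        ENNReal.ofReal L * Muskat.weightedNorm (fun ξ => lam ξ * |ξ| ^ s) (G i) := fun i =>
      Muskat.weightedNorm_le_of_le hL0 (Muskat.tamedWeight_le hL s) (G i)
    have hBle : B k j ≤ 1 + ∑ k, ∑ j, B k j := by
      linarith [Muskat.single_le_sum_sum hB0 k j]
    have hJ := Muskat.poissonMass_nonneg (d k - d j)
    refine le_trans ?_ (mul_le_mul_left (ENNReal.ofReal_le_ofReal hBle) _)
    refine (mul_le_mul_right (hHs.trans (mul_le_mul_right (add_le_add
      (mul_le_mul_right (add_le_add (hU k) (hU j)) _)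
      (mul_le_mul_right (add_le_add (hV k) (hV j)) _)) _)) _).trans_eq ?_
    have hBe : ENNReal.ofReal (B k j) = ENNReal.ofReal |Muskat.densityJump ρ j| *
        ENNReal.ofReal (16 * ((1 + |d k - d j|) * Muskat.poissonMass (d k - d j))) *
        ENNReal.ofReal L := by
      rw [← ENNReal.ofReal_mul (by positivity), ← ENNReal.ofReal_mul (by positivity)]
    rw [hBe]
    ring
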